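/- Let $\mathbb R_+=(0,\infty)$, let $m\ge 1$ and $d\ge 0$ be integers, and let $\mu\in C^m([0,\infty)\times\mathbb R^d,\mathbb R)$ satisfy: (a) for each integer $0\le l\le m$ there are a function $a_l\in L^2(\mathbb R_+)$ and a locally bounded function $b_l:\mathbb R^d\to[0,\infty)$ such that $$\bigl|\partial_x^l\mu(x,y)\bigr|\le a_l(x)+b_l(y)\,|y|\qquad\text{for all }x\in\mathbb R_+,\ y\in\mathbb R^d;$$ (b) for each multi-index $\alpha=(\alpha_1,\dots,\alpha_{d+1})$ (with $\alpha_1$ the order of differentiation in $x$) such that $\alpha_1\ne|\alpha|\le m$, the function $y\mapsto\sup_{x\in\mathbb R_+}|D^\alpha\mu(x,y)|$ is finite and locally bounded on $\mathbb R^d$. Let $H^m(\mathbb R_+)$ be the real Sobolev space of all $u\in L^2(\mathbb R_+)$ whose weak derivatives $u^{(k)}$, $0\le k\le m$, belong to $L^2(\mathbb R_+)$, with the norm $\|u\|_{H^m}^2=\sum_{k=0}^m\|u^{(k)}\|_{L^2}^2$. Then the Nemytskii operator $N(u)(x)=\mu(x,u(x))$ maps $(H^m(\mathbb R_+))^d$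 into $H^m(\mathbb R_+)$ and is continuous from $(H^m(\mathbb R_+))^d$ into $H^m(\mathbb R_+)$. -/

import Mathlib

open MeasureTheory Set Filter Topology
open scoped NNReal ENNReal ContDiff

noncomputable section

namespace Nemytskii

/-- Lebesgue measure on the open half line `(0, ∞)`. -/
abbrev halfLine : Measure ℝ := volume.restrict (Ioi (0 : ℝ))

/-- The real Hilbert space of square integrable functions on `(0, ∞)`. -/
abbrev L2 : Type := Lp ℝ 2 halfLine

/-- Test functions on `(0, ∞)`: smooth with compact support contained in `(0, ∞)`. -/
def IsTestFunction (φ : ℝ → ℝ) : Prop :=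
  ContDiff ℝ ∞ φ ∧ HasCompactSupport φ ∧ tsupport φ ⊆ Ioi 0

/-- `v` is the `k`-th weak derivative of `u` on `(0, ∞)`, for `u`, `v` square integrable. -/
def IsWeakDeriv (k : ℕ) (u v : L2) : Prop :=
  ∀ φ : ℝ → ℝ, IsTestFunction φ →
    ∫ x in Ioi (0 : ℝ), u x * iteratedDeriv k φ x
      = (-1) ^ k * ∫ x in Ioi (0 : ℝ), v x * φ x

theorem IsTestFunction.integrable_mul {φ : ℝ → ℝ} (h : IsTestFunction φ) (k : ℕ) (u : L2) :
    Integrable (fun x => u x * iteratedDeriv k φ x) halfLine := by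
  have hc : Continuous (iteratedDeriv k φ) :=
    h.1.continuous_iteratedDeriv k (by exact_mod_cast le_top)
  have hs : HasCompactSupport (iteratedDeriv k φ) := by
    refine h.2.1.mono' fun x hx => support_iteratedFDeriv_subset (𝕜 := ℝ) k ?_
    rw [Function.mem_support] at hx ⊢
    intro h0
    exact hx (by rw [iteratedDeriv, h0]; rfl)
  have hm : MemLp (iteratedDeriv k φ) 2 halfLine := hc.memLp_of_hasCompactSupport hs
  exact (Lp.memLp u).integrable_mul hm

theorem IsWeakDeriv.add {k : ℕ} {u v u' v' : L2} (h : IsWeakDeriv k u v)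
    (h' : IsWeakDeriv k u' v') : IsWeakDeriv k (u + u') (v + v') := by
  intro φ hφ
  have e1 : ∫ x in Ioi (0 : ℝ), (u + u' : L2) x * iteratedDeriv k φ x
      = ∫ x in Ioi (0 : ℝ), (u x * iteratedDeriv k φ x + u' x * iteratedDeriv k φ x) := by
    apply integral_congr_ae
    filter_upwards [Lp.coeFn_add u u'] with x hx
    rw [hx, Pi.add_apply, add_mul]
  have e2 : ∫ x in Ioi (0 : ℝ), (v + v' : L2) x * φ x
      = ∫ x in Ioi (0 : ℝ), (v x * φ x + v' x * φ x) := by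
    apply integral_congr_ae
    filter_upwards [Lp.coeFn_add v v'] with x hx
    rw [hx, Pi.add_apply, add_mul]
  rw [e1, e2, integral_add (hφ.integrable_mul k u) (hφ.integrable_mul k u'),
    integral_add (by simpa using hφ.integrable_mul 0 v) (by simpa using hφ.integrable_mul 0 v'),
    h φ hφ, h' φ hφ, mul_add]

theorem IsWeakDeriv.smul {k : ℕ} {u v : L2} (c : ℝ) (h : IsWeakDeriv k u v) :
    IsWeakDeriv k (c • u) (c • v) := by
  intro φ hφ
  have e1 : ∫ x in Ioi (0 : ℝ), (c • u : L2) x * iteratedDeriv k φ x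
      = ∫ x in Ioi (0 : ℝ), c * (u x * iteratedDeriv k φ x) := by
    apply integral_congr_ae
    filter_upwards [Lp.coeFn_smul c u] with x hx
    rw [hx, Pi.smul_apply, smul_eq_mul, mul_assoc]
  have e2 : ∫ x in Ioi (0 : ℝ), (c • v : L2) x * φ x
      = ∫ x in Ioi (0 : ℝ), c * (v x * φ x) := by
    apply integral_congr_ae
    filter_upwards [Lp.coeFn_smul c v] with x hx
    rw [hx, Pi.smul_apply, smul_eq_mul, mul_assoc]
  rw [e1, e2, integral_const_mul, integral_const_mul, h φ hφ]
  ring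

theorem IsWeakDeriv.zero (k : ℕ) : IsWeakDeriv k 0 0 := by
  have h : ∀ ψ : ℝ → ℝ, ∫ x in Ioi (0 : ℝ), (0 : L2) x * ψ x = 0 := by
    intro ψ
    apply integral_eq_zero_of_ae
    filter_upwards [Lp.coeFn_zero ℝ 2 halfLine] with x hx
    rw [hx, Pi.zero_apply, zero_mul]
  intro φ _
  rw [h, h, mul_zero]

/-- Weak derivatives are unique. -/
theorem IsWeakDeriv.unique {k : ℕ} {u v w : L2} (hv : IsWeakDeriv k u v)
    (hw : IsWeakDeriv k u w) : v = w := by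
  apply Lp.ext
  have hloc : ∀ f : L2, LocallyIntegrableOn f (Ioi (0 : ℝ)) volume := by
    intro f
    refine locallyIntegrableOn_of_locallyIntegrable_restrict ?_
    exact (Lp.memLp f).locallyIntegrable (by norm_num)
  have key : ∀ᵐ x, x ∈ Ioi (0 : ℝ) → (v x - w x) = 0 := by
    refine isOpen_Ioi.ae_eq_zero_of_integral_contDiff_smul_eq_zero
      ((hloc v).sub (hloc w)) ?_
    intro φ h1 h2 h3
    have ht : IsTestFunction φ := ⟨h1, h2, h3⟩
    have e : ∫ x in Ioi (0 : ℝ), v x * φ x = ∫ x in Ioi (0 : ℝ), w x * φ x := by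
      have := (hv φ ht).symm.trans (hw φ ht)
      exact mul_left_cancel₀ (pow_ne_zero k (by norm_num)) this
    have hi : ∀ f : L2, Integrable (fun x => f x * φ x) halfLine := fun f => by
      simpa using ht.integrable_mul 0 f
    rw [← setIntegral_eq_integral_of_forall_compl_eq_zero (s := Ioi (0 : ℝ))]
    · have : (∫ x in Ioi (0 : ℝ), φ x • (v x - w x))
          = ∫ x in Ioi (0 : ℝ), (v x * φ x - w x * φ x) := by
        congr 1
        ext x
        rw [smul_eq_mul]
        ring
      exact this.trans (by rw [integral_sub (hi v) (hi w), e, sub_self])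
    · intro x hx
      have : φ x = 0 := image_eq_zero_of_notMem_tsupport fun hx' => hx (h3 hx')
      simp [this]
  filter_upwards [(ae_restrict_iff' measurableSet_Ioi).2 key] with x hx
  exact sub_eq_zero.1 hx

/-- Square integrable functions on `(0, ∞)` whose weak derivatives up to order `m` exist and are
square integrable, as a linear subspace of `L2`. -/
def sobolevSubmodule (m : ℕ) : Submodule ℝ L2 where
  carrier := {u | ∀ k ≤ m, ∃ v : L2, IsWeakDeriv k u v}
  add_mem' := by
    intro u u' h h' k hk
    obtain ⟨v, hv⟩ := h k hk
    obtain ⟨v', hv'⟩ := h' k hk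
    exact ⟨v + v', hv.add hv'⟩
  zero_mem' := fun k _ => ⟨0, IsWeakDeriv.zero k⟩
  smul_mem' := by
    intro c u h k hk
    obtain ⟨v, hv⟩ := h k hk
    exact ⟨c • v, hv.smul c⟩

/-- The Sobolev space `H^m(0, ∞)`. It is a type of its own, since its norm is not the one that
it would inherit from `L2`. -/
def SobolevH (m : ℕ) : Type := sobolevSubmodule m

namespace SobolevH

variable {m : ℕ}

instance : AddCommGroup (SobolevH m) := inferInstanceAs (AddCommGroup (sobolevSubmodule m))

instance : Module ℝ (SobolevH m) := inferInstanceAs (Module ℝ (sobolevSubmodule m))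

/-- The inclusion of `H^m` into `L2`. -/
def toL2 : SobolevH m →ₗ[ℝ] L2 := (sobolevSubmodule m).subtype

instance : CoeFun (SobolevH m) (fun _ => ℝ → ℝ) := ⟨fun u => (toL2 u : ℝ → ℝ)⟩

theorem exists_weakDeriv (u : SobolevH m) (k : Fin (m + 1)) :
    ∃ v : L2, IsWeakDeriv k (toL2 u) v :=
  u.2 k (Nat.lt_succ_iff.1 k.2)

/-- The `k`-th weak derivative of an element of `H^m`, for `0 ≤ k ≤ m`. -/
def weakDeriv (k : Fin (m + 1)) (u : SobolevH m) : L2 := (exists_weakDeriv u k).choose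

theorem isWeakDeriv_weakDeriv (k : Fin (m + 1)) (u : SobolevH m) :
    IsWeakDeriv k (toL2 u) (weakDeriv k u) := (exists_weakDeriv u k).choose_spec

/-- The tuple of all weak derivatives up to order `m`, in the Hilbert sum of `m + 1` copies
of `L2`. -/
def jet : SobolevH m →ₗ[ℝ] PiLp 2 (fun _ : Fin (m + 1) => L2) where
  toFun u := WithLp.toLp 2 fun k => weakDeriv k u
  map_add' u v := by
    ext1 k
    refine (isWeakDeriv_weakDeriv k (u + v)).unique ?_
    rw [map_add]
    exact (isWeakDeriv_weakDeriv k u).add (isWeakDeriv_weakDeriv k v)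
  map_smul' c u := by
    ext1 k
    refine (isWeakDeriv_weakDeriv k (c • u)).unique ?_
    rw [map_smul]
    exact (isWeakDeriv_weakDeriv k u).smul c

theorem weakDeriv_zero (u : SobolevH m) : weakDeriv 0 u = toL2 u := by
  refine (isWeakDeriv_weakDeriv 0 u).unique ?_
  intro φ _
  simp

theorem jet_injective : Function.Injective (jet (m := m)) := by
  intro u v h
  have h0 : weakDeriv 0 u = weakDeriv 0 v :=
    congrFun (congrArg WithLp.ofLp h) 0
  rw [weakDeriv_zero, weakDeriv_zero] at h0
  exact Subtype.ext h0

/-- The Sobolev norm: `‖u‖² = ∑ k ≤ m, ‖u⁽ᵏ⁾‖²` with the norm of `L2` on the right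
(see `norm_sq_eq`). -/
instance : NormedAddCommGroup (SobolevH m) :=
  NormedAddCommGroup.induced (SobolevH m) (PiLp 2 (fun _ : Fin (m + 1) => L2)) jet jet_injective

instance : NormedSpace ℝ (SobolevH m) :=
  NormedSpace.induced ℝ (SobolevH m) (PiLp 2 (fun _ : Fin (m + 1) => L2)) jet

theorem norm_sq_eq (u : SobolevH m) : ‖u‖ ^ 2 = ∑ k : Fin (m + 1), ‖weakDeriv k u‖ ^ 2 :=
  PiLp.norm_sq_eq_of_L2 _ (jet u)

end SobolevH

/-- The coordinate directions of the multi-index `α = (l, β₁, …, β_d)`: the `x` direction `l` times,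
then the direction of `y_j` taken `β_j` times for each `j`. -/
def directions {d : ℕ} (l : ℕ) (β : Fin d → ℕ) : List (ℝ × EuclideanSpace ℝ (Fin d)) :=
  List.replicate l (1, 0) ++
    (List.finRange d).flatMap fun j => List.replicate (β j) (0, EuclideanSpace.single j 1)

/-- The partial derivative `D^α μ (x, y)`, `α = (l, β₁, …, β_d)`, of a function on
`[0, ∞) × ℝ^d` (one-sided in `x` at `x = 0`). -/
def partialDeriv {d : ℕ} (l : ℕ) (β : Fin d → ℕ) (μ : ℝ → EuclideanSpace ℝ (Fin d) → ℝ)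
    (x : ℝ) (y : EuclideanSpace ℝ (Fin d)) : ℝ :=
  iteratedFDerivWithin ℝ (directions l β).length (fun p => μ p.1 p.2) (Ici 0 ×ˢ univ) (x, y)
    (directions l β).get

/-- A function with values in `[0, ∞]` is locally bounded if every point has a neighbourhood on
which it is bounded by a finite constant. -/
def IsLocallyBounded {E : Type*} [TopologicalSpace E] (f : E → ℝ≥0∞) : Prop :=
  ∀ y, ∃ C : ℝ≥0, ∀ᶠ z in 𝓝 y, f z ≤ C

/-- The regularity and growth assumption of order `m` on `μ : [0, ∞) × ℝ^d → ℝ`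
(values of `μ` at negative `x` play no role). -/
structure GrowthAssumption {d : ℕ} (m : ℕ) (μ : ℝ → EuclideanSpace ℝ (Fin d) → ℝ) : Prop where
  contDiffOn : ContDiffOn ℝ m (fun p : ℝ × EuclideanSpace ℝ (Fin d) => μ p.1 p.2)
    (Ici 0 ×ˢ univ)
  growth : ∀ l ≤ m, ∃ (a : ℝ → ℝ) (b : EuclideanSpace ℝ (Fin d) → ℝ≥0),
    MemLp a 2 halfLine ∧ IsLocallyBounded (fun y => (b y : ℝ≥0∞)) ∧
      ∀ x > 0, ∀ y, |partialDeriv l 0 μ x y| ≤ a x + b y * ‖y‖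
  locallyBounded : ∀ (l : ℕ) (β : Fin d → ℕ), l ≠ l + ∑ j, β j → l + ∑ j, β j ≤ m →
    IsLocallyBounded (fun y => ⨆ x ∈ Ioi (0 : ℝ), ‖partialDeriv l β μ x y‖ₑ)

end Nemytskii

end

noncomputable section

namespace Nemytskii

/-! The proof is an induction on the order, driven by the chain rule `(μ(t,u))' = ∂ₓμ(t,u) + ∑ⱼ
∂_{yⱼ}μ(t,u) uⱼ'`. The first summand is a superposition of the same kind, of one order less. In each
other summand a function with bounded superpositions multiplies `uⱼ'`. Hence two classes of
functions: `Gr k`, with growth `a(t) + C|y|`, and `Bd k`, bounded over balls in `y`. An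
`x`-derivative of a `Gr` function stays in `Gr`, a `y`-derivative lands in `Bd`, and `Bd` is closed
under all derivatives, each at the cost of one order. Bounds over balls suffice because `H¹` embeds
in `L^∞` (`IsWeakDeriv.ae_abs_le`).

The two inductions are `ContH.supComp` for `G(t,u)` and `ContH.supMul` for `G(t,u) v`. They run on
families indexed by a space `X` (`ContH`), so that existence of weak derivatives and continuous
dependence are proved together. At order zero continuity is dominated convergence along sequences,
`H¹` convergence giving pointwise convergence almost everywhere. The chain rule is proved for
locally absolutely continuous representatives (`IsACPrimitive.comp`), which exist by the du
Bois-Reymond lemma. The theorem is the case where `X` is `(H^m)^d` and the family is the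
tautological one. -/

/-! ### Test functions and integration by parts -/

theorem IsTestFunction.exists_Icc {φ : ℝ → ℝ} (h : IsTestFunction φ) :
    ∃ a b : ℝ, 0 < a ∧ a ≤ b ∧ ∀ x ∉ Ioo a b, φ x = 0 ∧ deriv φ x = 0 := by
  obtain ⟨a, b, ha, hab, hs⟩ : ∃ a b : ℝ, 0 < a ∧ a ≤ b ∧ tsupport φ ⊆ Ioo a b := by
    have hK : IsCompact (tsupport φ) := h.2.1
    rcases (tsupport φ).eq_empty_or_nonempty with he | hne
    · exact ⟨1, 1, one_pos, le_rfl, by simp [he]⟩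
    · obtain ⟨p, hp⟩ := hK.exists_isLeast hne
      obtain ⟨q, hq⟩ := hK.exists_isGreatest hne
      have hp0 : 0 < p := h.2.2 hp.1
      have hpq : p ≤ q := hp.2 hq.1
      -- The open interval contains the whole support, so `φ` vanishes at both endpoints and
      -- integration by parts leaves no boundary terms.
      exact ⟨p / 2, q + 1, by linarith, by linarith, fun x hx =>
        ⟨by linarith [hp.2 hx], by linarith [hq.2 hx]⟩⟩
  refine ⟨a, b, ha, hab, fun x hx => ⟨image_eq_zero_of_notMem_tsupport fun h' => hx (hs h'), ?_⟩⟩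
  exact image_eq_zero_of_notMem_tsupport fun h' => hx (hs (tsupport_deriv_subset h'))

theorem isTestFunction_deriv {φ : ℝ → ℝ} (h : IsTestFunction φ) : IsTestFunction (deriv φ) :=
  ⟨(contDiff_infty_iff_deriv.1 h.1).2, h.2.1.deriv, tsupport_deriv_subset.trans h.2.2⟩

theorem setIntegral_Ioi_eq_intervalIntegral {f : ℝ → ℝ} {a b : ℝ} (ha : 0 ≤ a) (hab : a ≤ b)
    (hf : ∀ x ∉ Ioo a b, f x = 0) : ∫ x in Ioi (0 : ℝ), f x = ∫ x in a..b, f x := by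
  rw [intervalIntegral.integral_of_le hab]
  refine (setIntegral_eq_of_subset_of_forall_sdiff_eq_zero measurableSet_Ioi
    (fun x hx => ha.trans_lt hx.1) fun x hx => hf x fun h => hx.2 ⟨h.1, h.2.le⟩)

/-- `w` is locally absolutely continuous on `(0, ∞)`, with derivative `v` almost everywhere. -/
structure IsACPrimitive (w v : ℝ → ℝ) : Prop where
  ac : ∀ a b : ℝ, 0 < a → a ≤ b → AbsolutelyContinuousOnInterval w a b
  deriv : ∀ᵐ x ∂halfLine, HasDerivAt w (v x) x

theorem IsACPrimitive.ae_deriv_eq {w v : ℝ → ℝ} (h : IsACPrimitive w v) {a b : ℝ} (ha : 0 < a)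
    (hab : a ≤ b) : ∀ᵐ x, x ∈ uIoc a b → _root_.deriv w x = v x := by
  filter_upwards [(ae_restrict_iff' measurableSet_Ioi).1 h.deriv] with x hx hx'
  rw [uIoc_of_le hab] at hx'
  exact (hx (ha.trans hx'.1)).deriv

theorem IsACPrimitive.sub_eq {w v : ℝ → ℝ} (h : IsACPrimitive w v) {a b : ℝ} (ha : 0 < a)
    (hab : a ≤ b) : w b - w a = ∫ x in a..b, v x := by
  rw [← (h.ac a b ha hab).integral_deriv_eq_sub]
  exact intervalIntegral.integral_congr_ae (h.ae_deriv_eq ha hab)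

theorem IsACPrimitive.integral_mul_deriv {w v φ : ℝ → ℝ} (h : IsACPrimitive w v)
    (hφ : IsTestFunction φ) :
    ∫ x in Ioi (0 : ℝ), w x * _root_.deriv φ x = - ∫ x in Ioi (0 : ℝ), v x * φ x := by
  obtain ⟨a, b, ha, hab, hz⟩ := hφ.exists_Icc
  rw [setIntegral_Ioi_eq_intervalIntegral ha.le hab fun x hx => by rw [(hz x hx).2, mul_zero],
    setIntegral_Ioi_eq_intervalIntegral ha.le hab fun x hx => by rw [(hz x hx).1, mul_zero],
    (h.ac a b ha hab).integral_mul_deriv_eq_deriv_mul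
      (hφ.1.of_le (by exact_mod_cast le_top)).contDiffOn.absolutelyContinuousOnInterval,
    (hz a (by simp)).1, (hz b (by simp)).1, mul_zero, mul_zero, sub_zero, zero_sub]
  congr 1
  apply intervalIntegral.integral_congr_ae
  filter_upwards [h.ae_deriv_eq ha hab] with x hx hx'
  rw [hx hx']

theorem IsACPrimitive.isWeakDeriv {w : ℝ → ℝ} {u v : L2} (h : IsACPrimitive w v)
    (hu : u =ᵐ[halfLine] w) : IsWeakDeriv 1 u v := by
  intro φ hφ
  rw [iteratedDeriv_one, pow_one, neg_one_mul, ← h.integral_mul_deriv hφ]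
  apply integral_congr_ae
  filter_upwards [hu] with x hx
  rw [hx]

/-! ### The du Bois-Reymond lemma and absolutely continuous representatives -/

/-- The primitive based at the left end of an interval containing the support is zero to the left of
it, and zero to the right of it because the total integral vanishes. -/
theorem IsTestFunction.exists_deriv_eq {η : ℝ → ℝ} (h : IsTestFunction η)
    (h0 : ∫ x in Ioi (0 : ℝ), η x = 0) :
    ∃ Φ : ℝ → ℝ, IsTestFunction Φ ∧ deriv Φ = η := by
  obtain ⟨a, b, ha, hab, hz⟩ := h.exists_Icc
  have hc : Continuous η := h.1.continuous
  have hd : ∀ x, HasDerivAt (fun x => ∫ t in a..x, η t) (η x) x := fun x =>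
    intervalIntegral.integral_hasDerivAt_right (hc.intervalIntegrable _ _)
      hc.stronglyMeasurable.stronglyMeasurableAtFilter hc.continuousAt
  have hder : deriv (fun x => ∫ t in a..x, η t) = η := funext fun x => (hd x).deriv
  have hab0 : ∫ t in a..b, η t = 0 := by
    rw [← h0, setIntegral_Ioi_eq_intervalIntegral ha.le hab fun x hx => (hz x hx).1]
  have hsupp : ∀ x ∉ Icc a b, ∫ t in a..x, η t = 0 := by
    intro x hx
    rcases lt_or_ge x a with hxa | hxa
    · rw [intervalIntegral.integral_congr (g := fun _ => 0)]
      · simp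
      · intro t ht
        rw [uIcc_of_ge hxa.le] at ht
        exact (hz t fun h' => absurd ht.2 (not_le.2 h'.1)).1
    · have hxb : b < x := not_le.1 fun h' => hx ⟨hxa, h'⟩
      rw [← intervalIntegral.integral_add_adjacent_intervals (hc.intervalIntegrable a b)
        (hc.intervalIntegrable b x), hab0, zero_add,
        intervalIntegral.integral_congr (g := fun _ => 0)]
      · simp
      · intro t ht
        rw [uIcc_of_le hxb.le] at ht
        exact (hz t fun h' => absurd ht.1 (not_le.2 h'.2)).1
  have hts : tsupport (fun x => ∫ t in a..x, η t) ⊆ Icc a b :=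
    closure_minimal (fun x hx => by_contra fun h' => hx (hsupp x h')) isClosed_Icc
  refine ⟨_, ⟨?_, isCompact_Icc.of_isClosed_subset (isClosed_tsupport _) hts,
    hts.trans fun x hx => ha.trans_le hx.1⟩, hder⟩
  rw [contDiff_infty_iff_deriv, hder]
  exact ⟨fun x => (hd x).differentiableAt, h.1⟩

theorem exists_isTestFunction_integral_eq_one :
    ∃ ψ : ℝ → ℝ, IsTestFunction ψ ∧ ∫ x in Ioi (0 : ℝ), ψ x = 1 := by
  let b : ContDiffBump (2 : ℝ) := ⟨1 / 2, 1, by norm_num, by norm_num⟩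
  have hts : tsupport (b.normed volume) ⊆ Ioi 0 := by
    rw [b.tsupport_normed_eq, Real.closedBall_eq_Icc]
    intro x hx
    have : (2 : ℝ) - 1 ≤ x := hx.1
    exact lt_of_lt_of_le (by norm_num) this
  refine ⟨b.normed volume, ⟨b.contDiff_normed, b.hasCompactSupport_normed, hts⟩, ?_⟩
  rw [← b.integral_normed (μ := volume)]
  exact setIntegral_eq_integral_of_forall_compl_eq_zero fun x hx =>
    image_eq_zero_of_notMem_tsupport fun h => hx (hts h)

theorem IsTestFunction.integrable_mul_of_locallyIntegrableOn {φ f : ℝ → ℝ} (h : IsTestFunction φ)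
    (hf : LocallyIntegrableOn f (Ioi (0 : ℝ)) volume) :
    Integrable (fun x => f x * φ x) halfLine := by
  have h1 : IntegrableOn (fun x => f x * φ x) (tsupport φ) volume :=
    (hf.integrableOn_compact_subset h.2.2 h.2.1).mul_continuousOn
      h.1.continuous.continuousOn h.2.1
  refine (h1.integrable_of_forall_notMem_eq_zero fun x hx => ?_).integrableOn
  rw [image_eq_zero_of_notMem_tsupport hx, mul_zero]

theorem IsTestFunction.add_const_mul {φ ψ : ℝ → ℝ} (hφ : IsTestFunction φ) (hψ : IsTestFunction ψ)
    (c : ℝ) : IsTestFunction fun x => φ x + c * ψ x := by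
  have hs : HasCompactSupport fun x => c * ψ x := hψ.2.1.mul_left (f := fun _ => c)
  have ht : tsupport (fun x => c * ψ x) ⊆ tsupport ψ := tsupport_mul_subset_right (f := fun _ => c)
  refine ⟨hφ.1.add (contDiff_const.mul hψ.1), hφ.2.1.add hs, ?_⟩
  exact (tsupport_add φ _).trans (union_subset hφ.2.2 (ht.trans hψ.2.2))

/-- The du Bois-Reymond lemma on `(0, ∞)`. -/
theorem ae_eq_const_of_integral_mul_deriv_eq_zero {f : ℝ → ℝ}
    (hf : LocallyIntegrableOn f (Ioi (0 : ℝ)) volume)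
    (h : ∀ φ, IsTestFunction φ → ∫ x in Ioi (0 : ℝ), f x * deriv φ x = 0) :
    ∃ c : ℝ, ∀ᵐ x ∂halfLine, f x = c := by
  obtain ⟨ψ, hψ, hψ1⟩ := exists_isTestFunction_integral_eq_one
  set c := ∫ x in Ioi (0 : ℝ), f x * ψ x with hc
  refine ⟨c, ?_⟩
  have hconst : ∀ k : ℝ, LocallyIntegrableOn (fun _ : ℝ => k) (Ioi (0 : ℝ)) volume := fun k =>
    (locallyIntegrable_const k).locallyIntegrableOn _
  have key : ∀ᵐ x, x ∈ Ioi (0 : ℝ) → f x - c = 0 := by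
    refine isOpen_Ioi.ae_eq_zero_of_integral_contDiff_smul_eq_zero (hf.sub (hconst c)) ?_
    intro φ h1 h2 h3
    have hφ : IsTestFunction φ := ⟨h1, h2, h3⟩
    have hone : ∀ {θ}, IsTestFunction θ → Integrable θ halfLine := fun hθ => by
      simpa using hθ.integrable_mul_of_locallyIntegrableOn (hconst 1)
    set I := ∫ x in Ioi (0 : ℝ), φ x with hI
    -- Since `ψ` has integral one, `φ - I ψ` has mean zero and is therefore the derivative of a test
    -- function.
    obtain ⟨Φ, hΦ, hd⟩ := (hφ.add_const_mul hψ (-I)).exists_deriv_eq (by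
      rw [integral_add (hone hφ) ((hone hψ).const_mul _), integral_const_mul, hψ1, ← hI]
      ring)
    have h0 := h Φ hΦ
    rw [hd] at h0
    have hfφ := hφ.integrable_mul_of_locallyIntegrableOn hf
    have hfψ := hψ.integrable_mul_of_locallyIntegrableOn hf
    have e : ∫ x in Ioi (0 : ℝ), f x * (φ x + -I * ψ x)
        = (∫ x in Ioi (0 : ℝ), f x * φ x) - I * c := by
      rw [hc, ← integral_const_mul, ← integral_sub hfφ (hfψ.const_mul I)]
      congr 1
      ext x
      ring
    rw [← setIntegral_eq_integral_of_forall_compl_eq_zero (s := Ioi (0 : ℝ))]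
    · have : ∫ x in Ioi (0 : ℝ), φ x • (f x - c)
          = (∫ x in Ioi (0 : ℝ), f x * φ x) - I * c := by
        rw [hI, ← integral_mul_const, ← integral_sub hfφ ((hone hφ).mul_const c)]
        congr 1
        ext x
        rw [smul_eq_mul]
        ring
      exact this.trans (e.symm.trans h0)
    · intro x hx
      have : φ x = 0 := image_eq_zero_of_notMem_tsupport fun hx' => hx (h3 hx')
      simp [this]
  filter_upwards [(ae_restrict_iff' measurableSet_Ioi).2 key] with x hx
  exact sub_eq_zero.1 hx

theorem locallyIntegrable_indicator_L2 (v : L2) :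
    LocallyIntegrable ((Ioi (0 : ℝ)).indicator v) volume := by
  have : MemLp ((Ioi (0 : ℝ)).indicator v) 2 volume :=
    (memLp_indicator_iff_restrict measurableSet_Ioi).2 (Lp.memLp v)
  exact this.locallyIntegrable (by norm_num)

theorem locallyIntegrableOn_L2 (v : L2) : LocallyIntegrableOn v (Ioi (0 : ℝ)) volume :=
  locallyIntegrableOn_of_locallyIntegrable_restrict ((Lp.memLp v).locallyIntegrable (by norm_num))

/-- Extended by zero, `v` is locally integrable on the line, and Lebesgue differentiation applies to
its primitive. The base point `1` is arbitrary. -/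
theorem exists_isACPrimitive_L2 (v : L2) : ∃ w, IsACPrimitive w v := by
  have hv := locallyIntegrable_indicator_L2 v
  refine ⟨fun x => ∫ t in (1 : ℝ)..x, (Ioi (0 : ℝ)).indicator v t, ⟨fun a b ha hab => ?_, ?_⟩⟩
  · have hvi : IntervalIntegrable ((Ioi (0 : ℝ)).indicator v) volume (min a 1) (max b 1) :=
      (hv.integrableOn_isCompact isCompact_uIcc).intervalIntegrable
    have h1 : (1 : ℝ) ∈ uIcc (min a 1) (max b 1) := by
      rw [mem_uIcc]
      exact Or.inl ⟨min_le_right _ _, le_max_right _ _⟩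
    refine (hvi.absolutelyContinuousOnInterval_intervalIntegral h1).mono ?_
    exact uIcc_subset_uIcc (mem_uIcc.2 (Or.inl ⟨min_le_left _ _, hab.trans (le_max_left _ _)⟩))
      (mem_uIcc.2 (Or.inl ⟨(min_le_left _ _).trans hab, le_max_left _ _⟩))
  · filter_upwards [ae_restrict_of_ae (LocallyIntegrable.ae_hasDerivAt_integral hv),
      ae_restrict_mem measurableSet_Ioi] with x hx hx0
    have := hx 1
    rwa [indicator_of_mem hx0] at this

/-- A primitive `w` of `v` has the same weak derivative as `u`, so `u - w` annihilates derivatives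
of test functions and is a constant, which is absorbed into `w`. -/
theorem IsWeakDeriv.exists_isACPrimitive {u v : L2} (h : IsWeakDeriv 1 u v) :
    ∃ w, IsACPrimitive w v ∧ u =ᵐ[halfLine] w := by
  obtain ⟨w, hw⟩ := exists_isACPrimitive_L2 v
  have hwc : ContinuousOn w (Ioi 0) := by
    intro x hx
    have hx' : 0 < x := hx
    refine ((hw.ac (x / 2) (x + 1) (by linarith) (by linarith)).continuousOn.continuousAt
      ?_).continuousWithinAt
    rw [uIcc_of_le (by linarith)]
    exact Icc_mem_nhds (by linarith) (by linarith)
  have hwi : LocallyIntegrableOn w (Ioi (0 : ℝ)) volume :=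
    hwc.locallyIntegrableOn measurableSet_Ioi
  have hui := locallyIntegrableOn_L2 u
  obtain ⟨c, hc⟩ := ae_eq_const_of_integral_mul_deriv_eq_zero (hui.sub hwi) (by
    intro φ hφ
    have hdφ := isTestFunction_deriv hφ
    have e1 := h φ hφ
    rw [iteratedDeriv_one, pow_one, neg_one_mul, ← hw.integral_mul_deriv hφ] at e1
    have e2 : ∫ x in Ioi (0 : ℝ), (u x - w x) * _root_.deriv φ x
        = ∫ x in Ioi (0 : ℝ), (u x * _root_.deriv φ x - w x * _root_.deriv φ x) := by
      simp only [sub_mul]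
    refine e2.trans ?_
    rw [integral_sub (hdφ.integrable_mul_of_locallyIntegrableOn hui)
      (hdφ.integrable_mul_of_locallyIntegrableOn hwi), e1, sub_self])
  refine ⟨fun x => w x + c, ⟨fun a b ha hab => ?_, ?_⟩, ?_⟩
  · refine (hw.ac a b ha hab).add
      (ContDiffOn.absolutelyContinuousOnInterval (f := fun _ => c) contDiffOn_const)
  · filter_upwards [hw.deriv] with x hx using hx.add_const c
  · filter_upwards [hc] with x hx
    have : u x - w x = c := hx
    linarith

/-! ### The `L^∞` bound for `H¹` -/

/-- An interval of length one carries a probability measure, for which the `L¹` norm is at most the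
`L²` norm. -/
theorem intervalIntegral_abs_le_norm (v : L2) {t : ℝ} (ht : 0 < t) :
    ∫ x in t..t + 1, |v x| ≤ ‖v‖ := by
  have hp : IsProbabilityMeasure (volume.restrict (Ioc t (t + 1))) := ⟨by simp⟩
  have hle : volume.restrict (Ioc t (t + 1)) ≤ halfLine :=
    Measure.restrict_mono (fun x hx => ht.trans hx.1) le_rfl
  have hv : MemLp v 2 (volume.restrict (Ioc t (t + 1))) := (Lp.memLp v).mono_measure hle
  rw [intervalIntegral.integral_of_le (by linarith)]
  have h1 : ENNReal.ofReal (∫ x in Ioc t (t + 1), |v x|) = eLpNorm v 1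
      (volume.restrict (Ioc t (t + 1))) := by
    rw [eLpNorm_one_eq_lintegral_enorm, ← ofReal_integral_norm_eq_lintegral_enorm
      (hv.integrable (by norm_num))]
    rfl
  have h2 : eLpNorm v 1 (volume.restrict (Ioc t (t + 1))) ≤ eLpNorm v 2 halfLine :=
    (eLpNorm_le_eLpNorm_of_exponent_le (by norm_num) hv.1).trans (eLpNorm_mono_measure _ hle)
  rw [← h1] at h2
  rw [Lp.norm_def]
  exact (ENNReal.ofReal_le_iff_le_toReal (Lp.memLp v).2.ne).1 h2

/-- The embedding of `H¹` into `L^∞`. -/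
theorem IsWeakDeriv.ae_abs_le {u v : L2} (h : IsWeakDeriv 1 u v) :
    ∀ᵐ t ∂halfLine, |u t| ≤ ‖u‖ + ‖v‖ := by
  obtain ⟨w, hw, huw⟩ := h.exists_isACPrimitive
  filter_upwards [huw, ae_restrict_mem measurableSet_Ioi] with t ht (ht0 : 0 < t)
  have hvol : volume (Ioc t (t + 1)) = 1 := by simp
  have hwc : ContinuousOn w (Icc t (t + 1)) := by
    have := (hw.ac t (t + 1) ht0 (by linarith)).continuousOn
    rwa [uIcc_of_le (by linarith)] at this
  -- At some `s` within distance one of `t`, `|w|` is at most its average, hence at most `‖u‖`.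
  -- Moving from `s` to `t` costs at most `∫ |v| ≤ ‖v‖`.
  obtain ⟨s, hs, hle⟩ := exists_le_setAverage (μ := volume) (s := Ioc t (t + 1))
    (f := fun x => |w x|) (by rw [hvol]; exact one_ne_zero) (by rw [hvol]; exact ENNReal.one_ne_top)
    (hwc.abs.integrableOn_Icc.mono_set Ioc_subset_Icc_self)
  have hmean : |w s| ≤ ‖u‖ := by
    refine hle.trans (le_trans (le_of_eq ?_) (intervalIntegral_abs_le_norm u ht0))
    rw [setAverage_eq, measureReal_def, hvol, ENNReal.toReal_one, inv_one, one_smul,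
      intervalIntegral.integral_of_le (by linarith)]
    refine setIntegral_congr_ae measurableSet_Ioc ?_
    filter_upwards [(ae_restrict_iff' measurableSet_Ioi).1 huw] with x hx hx'
    rw [hx (ht0.trans hx'.1)]
  have hvi : ∀ a b : ℝ, t ≤ a → a ≤ b → IntervalIntegrable (fun x => |v x|) volume a b := by
    intro a b hta hab
    have := ((locallyIntegrableOn_L2 v).integrableOn_compact_subset
      (fun x hx => ht0.trans_le (hta.trans hx.1)) (isCompact_Icc (a := a) (b := b)))
    rw [intervalIntegrable_iff_integrableOn_Icc_of_le hab]
    exact this.abs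
  have hdiff : |w s - w t| ≤ ‖v‖ := by
    rw [hw.sub_eq ht0 hs.1.le]
    refine (intervalIntegral.abs_integral_le_integral_abs hs.1.le).trans ?_
    refine le_trans ?_ (intervalIntegral_abs_le_norm v ht0)
    exact intervalIntegral.integral_mono_interval le_rfl hs.1.le hs.2
      (Eventually.of_forall fun x => abs_nonneg _) (hvi t (t + 1) le_rfl (by linarith))
  rw [ht]
  have : |w t| ≤ |w s| + |w s - w t| := by
    have := abs_sub_abs_le_abs_sub (w t) (w s)
    rw [abs_sub_comm] at this
    linarith
  linarith

theorem IsWeakDeriv.sub {k : ℕ} {u v u' v' : L2} (h : IsWeakDeriv k u v)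
    (h' : IsWeakDeriv k u' v') : IsWeakDeriv k (u - u') (v - v') := by
  have := h.add (h'.smul (-1))
  simpa [sub_eq_add_neg] using this

/-! ### Convergence criteria in `L2` -/

theorem tendsto_eLpNorm_zero_of_dominated {p : ℕ → ℝ → ℝ} {h : ℝ → ℝ}
    (hm : ∀ n, AEStronglyMeasurable (p n) halfLine) (hp : ∀ n, ∀ᵐ t ∂halfLine, |p n t| ≤ h t)
    (hh : MemLp h 2 halfLine) (hlim : ∀ᵐ t ∂halfLine, Tendsto (fun n => p n t) atTop (𝓝 0)) :
    Tendsto (fun n => eLpNorm (p n) 2 halfLine) atTop (𝓝 0) := by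
  have e : ∀ f : ℝ → ℝ, eLpNorm f 2 halfLine = (∫⁻ t, ‖f t‖ₑ ^ (2 : ℝ) ∂halfLine) ^ (1 / 2 : ℝ) := by
    intro f
    rw [eLpNorm_eq_lintegral_rpow_enorm_toReal (by norm_num) (by norm_num), ENNReal.toReal_ofNat]
  have hfin : ∫⁻ t, ‖h t‖ₑ ^ (2 : ℝ) ∂halfLine ≠ ⊤ := by
    have := hh.2
    rw [e] at this
    exact ((ENNReal.rpow_lt_top_iff_of_pos (by norm_num)).1 this).ne
  have key : Tendsto (fun n => ∫⁻ t, ‖p n t‖ₑ ^ (2 : ℝ) ∂halfLine) atTop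
      (𝓝 (∫⁻ _, 0 ∂halfLine)) := by
    refine tendsto_lintegral_of_dominated_convergence' (fun t => ‖h t‖ₑ ^ (2 : ℝ))
      (fun n => (hm n).enorm.pow_const _) (fun n => ?_) hfin ?_
    · filter_upwards [hp n] with t ht
      refine ENNReal.rpow_le_rpow ?_ (by norm_num)
      rw [enorm_le_iff_norm_le]
      exact ht.trans (le_abs_self _)
    · filter_upwards [hlim] with t ht
      have := (ENNReal.continuous_rpow_const (y := (2 : ℝ))).tendsto _ |>.comp ht.enorm
      simpa [Function.comp_def] using this
  rw [lintegral_zero] at key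
  have := (ENNReal.continuous_rpow_const (y := (1 / 2 : ℝ))).tendsto _ |>.comp key
  rw [ENNReal.zero_rpow_of_pos (by norm_num)] at this
  exact this.congr fun n => (e (p n)).symm

/-- Meant for sequences without a fixed dominating function: `p` is the part treated by dominated
convergence, `e` the part that is small in norm. -/
theorem tendsto_L2_of_abs_sub_le {f : ℕ → L2} {g : L2} {p e : ℕ → ℝ → ℝ}
    (hle : ∀ n, ∀ᵐ t ∂halfLine, |f n t - g t| ≤ p n t + e n t)
    (hpm : ∀ n, AEStronglyMeasurable (p n) halfLine)
    (hem : ∀ n, AEStronglyMeasurable (e n) halfLine)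
    (hp : Tendsto (fun n => eLpNorm (p n) 2 halfLine) atTop (𝓝 0))
    (he : Tendsto (fun n => eLpNorm (e n) 2 halfLine) atTop (𝓝 0)) :
    Tendsto f atTop (𝓝 g) := by
  rw [Lp.tendsto_Lp_iff_tendsto_eLpNorm']
  have hs := hp.add he
  rw [add_zero] at hs
  refine tendsto_of_tendsto_of_tendsto_of_le_of_le tendsto_const_nhds hs (fun _ => zero_le)
    fun n => ?_
  refine le_trans (eLpNorm_mono_ae (g := p n + e n) ?_)
    (eLpNorm_add_le (hpm n) (hem n) one_le_two)
  filter_upwards [hle n] with t ht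
  rw [Pi.sub_apply, Pi.add_apply, Real.norm_eq_abs, Real.norm_eq_abs]
  exact ht.trans (le_abs_self _)

/-- The class of `f` in `L2`, or `0` if `f` is not square integrable. -/
def mkL2 (f : ℝ → ℝ) : L2 :=
  open Classical in if h : MemLp f 2 halfLine then h.toLp f else 0

theorem coeFn_mkL2 {f : ℝ → ℝ} (h : MemLp f 2 halfLine) : mkL2 f =ᵐ[halfLine] f := by
  rw [mkL2, dif_pos h]
  exact h.coeFn_toLp

/-! ### Families depending continuously on a parameter -/

variable {X : Type*} [TopologicalSpace X]

/-- A family of elements of `L2` that is continuous as a map into the Sobolev space of order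
`k`. -/
def ContH : ℕ → (X → L2) → Prop
  | 0, F => Continuous F
  | k + 1, F => Continuous F ∧ ∃ F' : X → L2, (∀ x, IsWeakDeriv 1 (F x) (F' x)) ∧ ContH k F'

theorem ContH.continuous {k : ℕ} {F : X → L2} (h : ContH k F) : Continuous F := by
  cases k with
  | zero => exact h
  | succ k => exact h.1

theorem ContH.of_succ {k : ℕ} {F : X → L2} (h : ContH (k + 1) F) : ContH k F := by
  induction k generalizing F with
  | zero => exact h.1
  | succ k ih =>
    obtain ⟨h1, F', h2, h3⟩ := h
    exact ⟨h1, F', h2, ih h3⟩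

theorem ContH.mono {k l : ℕ} (hkl : k ≤ l) {F : X → L2} (h : ContH l F) : ContH k F := by
  induction hkl with
  | refl => exact h
  | step _ ih => exact ih h.of_succ

theorem ContH.add {k : ℕ} {F G : X → L2} (hF : ContH k F) (hG : ContH k G) :
    ContH k (fun x => F x + G x) := by
  induction k generalizing F G with
  | zero => exact Continuous.add hF hG
  | succ k ih =>
    obtain ⟨h1, F', h2, h3⟩ := hF
    obtain ⟨h1', G', h2', h3'⟩ := hG
    exact ⟨h1.add h1', _, fun x => (h2 x).add (h2' x), ih h3 h3'⟩

theorem ContH.zero (k : ℕ) : ContH k (fun _ : X => (0 : L2)) := by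
  induction k with
  | zero => exact continuous_const
  | succ k ih => exact ⟨continuous_const, _, fun _ => IsWeakDeriv.zero 1, ih⟩

theorem ContH.sum {k : ℕ} {ι : Type*} {F : ι → X → L2} (s : Finset ι)
    (h : ∀ i, ContH k (F i)) : ContH k (fun x => ∑ i ∈ s, F i x) := by
  classical
  induction s using Finset.induction_on with
  | empty => simpa using ContH.zero k
  | insert i s hi ih =>
    simp only [Finset.sum_insert hi]
    exact (h i).add ih

/-- The point `(t, y)` of `ℝ × ℝ^d`. -/
def pt {d : ℕ} (t : ℝ) (y : Fin d → ℝ) : ℝ × EuclideanSpace ℝ (Fin d) := (t, WithLp.toLp 2 y)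

theorem norm_toLp_le_sum {d : ℕ} (y : Fin d → ℝ) :
    ‖(WithLp.toLp 2 y : EuclideanSpace ℝ (Fin d))‖ ≤ ∑ j, |y j| := by
  rw [EuclideanSpace.norm_eq, Real.sqrt_le_left (Finset.sum_nonneg fun _ _ => abs_nonneg _)]
  exact Finset.sum_sq_le_sq_sum_of_nonneg fun _ _ => abs_nonneg _

/-- Continuity of a family in `H¹` gives almost uniform bounds and pointwise convergence. -/
theorem ContH.exists_bound_tendsto {d : ℕ} {u : Fin d → X → L2} (hu : ∀ j, ContH 1 (u j))
    {x : ℕ → X} {x₀ : X} (hx : Tendsto x atTop (𝓝 x₀)) :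
    (∃ R : ℝ, (∀ n, ∀ᵐ t ∂halfLine,
        ‖(WithLp.toLp 2 fun j => u j (x n) t : EuclideanSpace ℝ (Fin d))‖ ≤ R) ∧
      ∀ᵐ t ∂halfLine, ‖(WithLp.toLp 2 fun j => u j x₀ t : EuclideanSpace ℝ (Fin d))‖ ≤ R) ∧
    ∀ᵐ t ∂halfLine, Tendsto (fun n => pt t fun j => u j (x n) t) atTop
      (𝓝 (pt t fun j => u j x₀ t)) := by
  choose hc u' hw hc' using hu
  have hpt : ∀ᵐ t ∂halfLine, Tendsto (fun n => pt t fun j => u j (x n) t) atTop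
      (𝓝 (pt t fun j => u j x₀ t)) := by
    -- The `L^∞` bound is applied to differences. The whole sequence converges, so no subsequence
    -- has to be extracted.
    have h1 : ∀ᵐ t ∂halfLine, ∀ j n, |u j (x n) t - u j x₀ t|
        ≤ ‖u j (x n) - u j x₀‖ + ‖u' j (x n) - u' j x₀‖ := by
      rw [ae_all_iff]
      intro j
      rw [ae_all_iff]
      intro n
      filter_upwards [((hw j (x n)).sub (hw j x₀)).ae_abs_le,
        Lp.coeFn_sub (u j (x n)) (u j x₀)] with t ht ht'
      rwa [ht', Pi.sub_apply] at ht
    filter_upwards [h1] with t ht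
    refine tendsto_const_nhds.prodMk_nhds (((PiLp.continuous_toLp 2 _).tendsto _).comp
      (tendsto_pi_nhds.2 fun j => ?_))
    rw [tendsto_iff_norm_sub_tendsto_zero]
    refine squeeze_zero (fun _ => norm_nonneg _) (ht j) ?_
    have e1 := tendsto_iff_norm_sub_tendsto_zero.1 (((hc j).tendsto x₀).comp hx)
    have e2 := tendsto_iff_norm_sub_tendsto_zero.1
      (((ContH.continuous (k := 0) (hc' j)).tendsto x₀).comp hx)
    simpa using e1.add e2
  have hb : ∃ R : ℝ, ∀ n, ∀ᵐ t ∂halfLine,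
      ‖(WithLp.toLp 2 fun j => u j (x n) t : EuclideanSpace ℝ (Fin d))‖ ≤ R := by
    have h1 : ∀ j, ∃ R : ℝ, ∀ n, ‖u j (x n)‖ + ‖u' j (x n)‖ ≤ R := by
      intro j
      have e1 := (((hc j).tendsto x₀).comp hx).norm
      have e2 := (((ContH.continuous (k := 0) (hc' j)).tendsto x₀).comp hx).norm
      obtain ⟨R, hR⟩ := (e1.add e2).bddAbove_range
      exact ⟨R, fun n => hR ⟨n, rfl⟩⟩
    choose R hR using h1
    refine ⟨∑ j, R j, fun n => ?_⟩
    have h2 : ∀ᵐ t ∂halfLine, ∀ j, |u j (x n) t| ≤ R j := by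
      rw [ae_all_iff]
      intro j
      filter_upwards [(hw j (x n)).ae_abs_le] with t ht using ht.trans (hR j n)
    filter_upwards [h2] with t ht
    exact (norm_toLp_le_sum _).trans (Finset.sum_le_sum fun j _ => ht j)
  obtain ⟨R, hR⟩ := hb
  refine ⟨⟨R, hR, ?_⟩, hpt⟩
  filter_upwards [ae_all_iff.2 hR, hpt] with t ht ht'
  exact le_of_tendsto ((continuous_snd.norm.tendsto _).comp ht') (Eventually.of_forall ht)

/-! ### The chain rule along absolutely continuous curves -/

theorem _root_.AbsolutelyContinuousOnInterval.lipschitzOnWith_comp {Y Z : Type*}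
    [PseudoMetricSpace Y] [PseudoMetricSpace Z] {f : ℝ → Y} {g : Y → Z} {a b : ℝ} {s : Set Y}
    {K : ℝ≥0} (hf : AbsolutelyContinuousOnInterval f a b) (hg : LipschitzOnWith K g s)
    (hs : MapsTo f (uIcc a b) s) : AbsolutelyContinuousOnInterval (g ∘ f) a b := by
  rw [absolutelyContinuousOnInterval_iff] at hf ⊢
  intro ε hε
  -- `K + 1` in place of `K` covers `K = 0` and makes the final inequality strict.
  obtain ⟨δ, hδ, h⟩ := hf (ε / (K + 1)) (by positivity)
  refine ⟨δ, hδ, fun E hE hEδ => ?_⟩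
  calc ∑ i ∈ Finset.range E.1, dist ((g ∘ f) (E.2 i).1) ((g ∘ f) (E.2 i).2)
      ≤ ∑ i ∈ Finset.range E.1, K * dist (f (E.2 i).1) (f (E.2 i).2) :=
        Finset.sum_le_sum fun i hi =>
          hg.dist_le_mul _ (hs (hE.1 i hi).1) _ (hs (hE.1 i hi).2)
    _ = K * ∑ i ∈ Finset.range E.1, dist (f (E.2 i).1) (f (E.2 i).2) := by rw [Finset.mul_sum]
    _ ≤ K * (ε / (K + 1)) := by gcongr; exact (h E hE hEδ).le
    _ < ε := by
      rw [mul_div_assoc', div_lt_iff₀ (by positivity)]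
      nlinarith

/-- The coordinate directions of `ℝ × ℝ^d`. -/
def dir {d : ℕ} : Option (Fin d) → ℝ × EuclideanSpace ℝ (Fin d)
  | none => (1, 0)
  | some j => (0, EuclideanSpace.single j 1)

/-- The partial derivative in a coordinate direction. -/
def pd {d : ℕ} (i : Option (Fin d)) (G : ℝ × EuclideanSpace ℝ (Fin d) → ℝ)
    (p : ℝ × EuclideanSpace ℝ (Fin d)) : ℝ :=
  fderiv ℝ G p (dir i)

/-- The open set `(0, ∞) × ℝ^d`. -/
abbrev domain (d : ℕ) : Set (ℝ × EuclideanSpace ℝ (Fin d)) := Ioi 0 ×ˢ univ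

theorem isOpen_domain (d : ℕ) : IsOpen (domain d) := isOpen_Ioi.prod isOpen_univ

theorem pt_mem_domain {d : ℕ} {t : ℝ} (ht : 0 < t) (y : Fin d → ℝ) : pt t y ∈ domain d :=
  ⟨ht, mem_univ _⟩

/-- This form reduces absolute continuity and differentiability of `t ↦ (t, w t)` to those of the
scalar coefficients. -/
theorem pt_eq {d : ℕ} (t : ℝ) (y : Fin d → ℝ) :
    pt t y = t • dir none + ∑ j, y j • dir (some j) := by
  refine Prod.ext ?_ ?_
  · simp [pt, dir, Prod.fst_sum]
  · ext i
    simp [pt, dir, Prod.snd_sum, Finset.sum_apply, Pi.single_apply]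

theorem IsACPrimitive.congr {w v v' : ℝ → ℝ} (h : IsACPrimitive w v) (hv : v =ᵐ[halfLine] v') :
    IsACPrimitive w v' := by
  refine ⟨h.ac, ?_⟩
  filter_upwards [h.deriv, hv] with x hx hx'
  rwa [← hx']

theorem IsACPrimitive.mul {w v w' v' : ℝ → ℝ} (h : IsACPrimitive w v) (h' : IsACPrimitive w' v') :
    IsACPrimitive (fun t => w t * w' t) (fun t => v t * w' t + w t * v' t) := by
  refine ⟨fun a b ha hab => (h.ac a b ha hab).mul (h'.ac a b ha hab), ?_⟩
  filter_upwards [h.deriv, h'.deriv] with x hx hx' using hx.mul hx'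

theorem absolutelyContinuousOnInterval_pt {d : ℕ} {w : Fin d → ℝ → ℝ} {a b : ℝ}
    (hw : ∀ j, AbsolutelyContinuousOnInterval (w j) a b) :
    AbsolutelyContinuousOnInterval (fun t => pt t fun j => w j t) a b := by
  have hc : ∀ z : ℝ × EuclideanSpace ℝ (Fin d),
      AbsolutelyContinuousOnInterval (fun _ => z) a b := fun z =>
    ContDiffOn.absolutelyContinuousOnInterval contDiffOn_const
  have hid : AbsolutelyContinuousOnInterval (fun t : ℝ => t) a b :=
    ContDiffOn.absolutelyContinuousOnInterval contDiffOn_id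
  have hs : ∀ s : Finset (Fin d), AbsolutelyContinuousOnInterval
      (fun t => t • dir none + ∑ j ∈ s, w j t • dir (some j)) a b := by
    classical
    intro s
    induction s using Finset.induction_on with
    | empty => simpa using! hid.smul (hc (dir none))
    | insert i s hi ih =>
      have e : (fun t => t • dir none + ∑ j ∈ insert i s, w j t • dir (some j))
          = (fun t => t • dir none + ∑ j ∈ s, w j t • dir (some j))
            + w i • fun _ => dir (some i) := by
        funext t
        rw [Finset.sum_insert hi, Pi.add_apply, Pi.smul_apply']
        abel
      rw [e]
      exact ih.add ((hw i).smul (hc (dir (some i))))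
  simpa only [pt_eq] using hs Finset.univ

/-- The chain rule for superposition with locally absolutely continuous functions. -/
theorem IsACPrimitive.comp {d : ℕ} {G : ℝ × EuclideanSpace ℝ (Fin d) → ℝ}
    (hG : ContDiffOn ℝ 1 G (domain d)) {w w' : Fin d → ℝ → ℝ}
    (hw : ∀ j, IsACPrimitive (w j) (w' j)) :
    IsACPrimitive (fun t => G (pt t fun j => w j t))
      (fun t => pd none G (pt t fun j => w j t)
        + ∑ j, pd (some j) G (pt t fun j => w j t) * w' j t) := by
  constructor
  · intro a b ha hab
    have hpt := absolutelyContinuousOnInterval_pt fun j => (hw j).ac a b ha hab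
    obtain ⟨R, hR⟩ := hpt.exists_bound
    -- On `[a, b]` the curve stays in a compact convex subset of the domain, where the `C¹` function
    -- `G` is Lipschitz.
    have hsub : Icc a b ×ˢ Metric.closedBall (0 : EuclideanSpace ℝ (Fin d)) R ⊆ domain d :=
      prod_mono (fun x hx => ha.trans_le hx.1) (subset_univ _)
    obtain ⟨K, hK⟩ := (hG.mono hsub).exists_lipschitzOnWith one_ne_zero
      ((convex_Icc a b).prod (convex_closedBall _ _)) (isCompact_Icc.prod (isCompact_closedBall _ _))
    refine hpt.lipschitzOnWith_comp hK fun t ht => ⟨?_, ?_⟩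
    · rwa [uIcc_of_le hab] at ht
    · rw [mem_closedBall_zero_iff]
      exact (norm_snd_le (pt t fun j => w j t)).trans (hR t ht)
  · filter_upwards [ae_all_iff.2 fun j => (hw j).deriv, ae_restrict_mem measurableSet_Ioi]
      with t ht ht0
    have hd : HasFDerivAt G (fderiv ℝ G (pt t fun j => w j t)) (pt t fun j => w j t) :=
      ((hG.differentiableOn one_ne_zero).differentiableAt
        ((isOpen_domain d).mem_nhds (pt_mem_domain ht0 _))).hasFDerivAt
    have hp : HasDerivAt (fun t => pt t fun j => w j t)
        (dir none + ∑ j, w' j t • dir (some j)) t := by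
      simp only [pt_eq]
      have h1 := (hasDerivAt_id t).smul_const (dir none : ℝ × EuclideanSpace ℝ (Fin d))
      rw [one_smul] at h1
      exact h1.add (HasDerivAt.fun_sum fun j _ => (ht j).smul_const _)
    have := hd.comp_hasDerivAt t hp
    rw [map_add, map_sum] at this
    refine this.congr_deriv ?_
    simp only [map_smul, smul_eq_mul, pd, mul_comm]

/-- `G` is controlled only on the open domain; its extension by zero is measurable everywhere and
agrees with it along the curve. -/
theorem aestronglyMeasurable_comp_pt {d : ℕ} {G : ℝ × EuclideanSpace ℝ (Fin d) → ℝ}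
    (hG : ContinuousOn G (domain d)) (u : Fin d → L2) :
    AEStronglyMeasurable (fun t => G (pt t fun j => u j t)) halfLine := by
  classical
  have hm : Measurable ((domain d).piecewise G fun _ => 0) :=
    hG.measurable_piecewise continuousOn_const (isOpen_domain d).measurableSet
  have hp : AEMeasurable (fun t => pt t fun j => u j t) halfLine := by
    refine aemeasurable_id.prodMk ((WithLp.measurable_toLp 2 _).comp_aemeasurable ?_)
    exact aemeasurable_pi_lambda _ fun j => (Lp.aestronglyMeasurable (u j)).aemeasurable
  refine (hm.comp_aemeasurable hp).aestronglyMeasurable.congr ?_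
  filter_upwards [ae_restrict_mem measurableSet_Ioi] with t ht
  exact piecewise_eq_of_mem _ _ _ (pt_mem_domain ht _)

/-! ### Products `G(t, u) v` with `G` bounded over balls -/

/-- Bounded on `(0, ∞) × B` for every ball `B`. -/
def BoundedOnBalls {d : ℕ} (G : ℝ × EuclideanSpace ℝ (Fin d) → ℝ) : Prop :=
  ∀ R : ℝ, ∃ C : ℝ, ∀ t > 0, ∀ y, ‖y‖ ≤ R → |G (t, y)| ≤ C

/-- All partial derivatives up to order `k` are continuous and bounded on `(0, ∞) × B` for every
ball `B`. -/
def Bd {d : ℕ} : ℕ → (ℝ × EuclideanSpace ℝ (Fin d) → ℝ) → Prop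
  | 0, G => ContinuousOn G (domain d) ∧ BoundedOnBalls G
  | k + 1, G => (ContDiffOn ℝ 1 G (domain d) ∧ BoundedOnBalls G) ∧ ∀ i, Bd k (pd i G)

theorem Bd.base {d k : ℕ} {G : ℝ × EuclideanSpace ℝ (Fin d) → ℝ} (h : Bd k G) : Bd 0 G := by
  cases k with
  | zero => exact h
  | succ k => exact ⟨h.1.1.continuousOn, h.1.2⟩

theorem Bd.const {d : ℕ} (k : ℕ) (c : ℝ) :
    Bd k (fun _ : ℝ × EuclideanSpace ℝ (Fin d) => c) := by
  induction k generalizing c with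
  | zero => exact ⟨continuousOn_const, fun _ => ⟨|c|, fun _ _ _ _ => le_rfl⟩⟩
  | succ k ih =>
    refine ⟨⟨contDiffOn_const, fun _ => ⟨|c|, fun _ _ _ _ => le_rfl⟩⟩, fun i => ?_⟩
    have : pd i (fun _ : ℝ × EuclideanSpace ℝ (Fin d) => c) = fun _ => 0 := by
      funext p
      simp [pd]
    rw [this]
    exact ih 0

/-- With a coordinate as `G`, `supMul` is the pointwise product of two functions, so `ContH.supMul`
also covers products of Sobolev functions. -/
theorem Bd.coord {d : ℕ} (k : ℕ) (j : Fin d) :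
    Bd k (fun p : ℝ × EuclideanSpace ℝ (Fin d) => p.2 j) := by
  have hb : BoundedOnBalls (fun p : ℝ × EuclideanSpace ℝ (Fin d) => p.2 j) := fun R =>
    ⟨R, fun t _ y hy => (PiLp.norm_apply_le y j).trans hy⟩
  let L : ℝ × EuclideanSpace ℝ (Fin d) →L[ℝ] ℝ :=
    (EuclideanSpace.proj j).comp (ContinuousLinearMap.snd ℝ ℝ (EuclideanSpace ℝ (Fin d)))
  cases k with
  | zero => exact ⟨L.continuous.continuousOn, hb⟩
  | succ k =>
    refine ⟨⟨L.contDiff.contDiffOn, hb⟩, fun i => ?_⟩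
    have : pd i (fun p : ℝ × EuclideanSpace ℝ (Fin d) => p.2 j) = fun _ => L (dir i) := by
      funext p
      have : fderiv ℝ (fun p : ℝ × EuclideanSpace ℝ (Fin d) => p.2 j) p = L := L.fderiv
      rw [pd, this]
    rw [this]
    exact Bd.const k _

theorem Bd.exists_abs_le {d k : ℕ} {G : ℝ × EuclideanSpace ℝ (Fin d) → ℝ} (h : Bd k G) (R : ℝ) :
    ∃ C : ℝ, 0 ≤ C ∧ ∀ t > 0, ∀ y : Fin d → ℝ,
      ‖(WithLp.toLp 2 y : EuclideanSpace ℝ (Fin d))‖ ≤ R → |G (pt t y)| ≤ C := by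
  obtain ⟨C, hC⟩ := h.base.2 R
  exact ⟨max C 0, le_max_right _ _, fun t ht y hy => (hC t ht _ hy).trans (le_max_left _ _)⟩

theorem IsWeakDeriv.exists_norm_toLp_le {d : ℕ} {u u' : Fin d → L2}
    (h : ∀ j, IsWeakDeriv 1 (u j) (u' j)) : ∃ R : ℝ, ∀ᵐ t ∂halfLine,
      ‖(WithLp.toLp 2 fun j => u j t : EuclideanSpace ℝ (Fin d))‖ ≤ R := by
  refine ⟨∑ j, (‖u j‖ + ‖u' j‖), ?_⟩
  filter_upwards [ae_all_iff.2 fun j => (h j).ae_abs_le] with t ht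
  exact (norm_toLp_le_sum _).trans (Finset.sum_le_sum fun j _ => ht j)

theorem Bd.memLp {d k : ℕ} {G : ℝ × EuclideanSpace ℝ (Fin d) → ℝ} (hG : Bd k G)
    {u u' : Fin d → L2} (h : ∀ j, IsWeakDeriv 1 (u j) (u' j)) (v : L2) :
    MemLp (fun t => G (pt t fun j => u j t) * v t) 2 halfLine := by
  obtain ⟨R, hR⟩ := IsWeakDeriv.exists_norm_toLp_le h
  obtain ⟨C, hC0, hC⟩ := hG.exists_abs_le R
  refine ((Lp.memLp v).norm.const_mul C).mono'
    ((aestronglyMeasurable_comp_pt hG.base.1 u).mul (Lp.aestronglyMeasurable v)) ?_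
  filter_upwards [hR, ae_restrict_mem measurableSet_Ioi] with t ht ht0
  rw [norm_mul]
  exact mul_le_mul_of_nonneg_right (hC t ht0 _ ht) (norm_nonneg _)

/-- The family of functions `G(t, u(t)) v(t)`. -/
def supMul {d : ℕ} (G : ℝ × EuclideanSpace ℝ (Fin d) → ℝ) (u : Fin d → X → L2) (v : X → L2)
    (x : X) : L2 :=
  mkL2 fun t => G (pt t fun j => u j x t) * v x t

theorem Bd.coeFn_supMul {d k : ℕ} {G : ℝ × EuclideanSpace ℝ (Fin d) → ℝ} (hG : Bd k G)
    {u : Fin d → X → L2} (hu : ∀ j, ContH 1 (u j)) (v : X → L2) (x : X) :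
    supMul G u v x =ᵐ[halfLine] fun t => G (pt t fun j => u j x t) * v x t := by
  choose _ u' hw _ using hu
  exact coeFn_mkL2 (hG.memLp (fun j => hw j x) (v x))

theorem tendsto_comp_pt {d : ℕ} {G : ℝ × EuclideanSpace ℝ (Fin d) → ℝ}
    (hG : ContinuousOn G (domain d)) {u : ℕ → Fin d → ℝ} {u₀ : Fin d → ℝ} {t : ℝ} (ht : 0 < t)
    (h : Tendsto (fun n => pt t (u n)) atTop (𝓝 (pt t u₀))) :
    Tendsto (fun n => G (pt t (u n))) atTop (𝓝 (G (pt t u₀))) :=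
  ((hG.continuousAt ((isOpen_domain d).mem_nhds (pt_mem_domain ht _))).tendsto).comp h

theorem Bd.continuous_supMul [SequentialSpace X] {d : ℕ}
    {G : ℝ × EuclideanSpace ℝ (Fin d) → ℝ} (hG : Bd 0 G)
    {u : Fin d → X → L2} (hu : ∀ j, ContH 1 (u j)) {v : X → L2} (hv : Continuous v) :
    Continuous (supMul G u v) := by
  rw [continuous_iff_seqContinuous]
  intro x x₀ hx
  obtain ⟨⟨R, hR, hR₀⟩, hlim⟩ := ContH.exists_bound_tendsto hu hx
  obtain ⟨C, hC0, hC⟩ := hG.exists_abs_le R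
  have hGm : ∀ x, AEStronglyMeasurable (fun t => G (pt t fun j => u j x t)) halfLine := fun x =>
    aestronglyMeasurable_comp_pt hG.1 fun j => u j x
  -- The product is varied one factor at a time: the change of `G` is multiplied by the fixed `v x₀`
  -- and dominated by `2 C |v x₀|`, the change of `v` is small in norm with factor `C`.
  have hpm : ∀ n, AEStronglyMeasurable (fun t => |(G (pt t fun j => u j (x n) t)
      - G (pt t fun j => u j x₀ t)) * v x₀ t|) halfLine := fun n =>
    (((hGm _).sub (hGm _)).mul (Lp.aestronglyMeasurable (v x₀))).norm
  have hem : ∀ n, AEStronglyMeasurable (fun t => C * |(v (x n) - v x₀ : L2) t|) halfLine :=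
    fun n => (Lp.aestronglyMeasurable (v (x n) - v x₀)).norm.const_mul C
  refine tendsto_L2_of_abs_sub_le (fun n => ?_) hpm hem ?_ ?_
  · filter_upwards [hG.coeFn_supMul hu v (x n), hG.coeFn_supMul hu v x₀, hR n,
      Lp.coeFn_sub (v (x n)) (v x₀), ae_restrict_mem measurableSet_Ioi] with t h1 h2 h3 h4 h5
    rw [Function.comp_apply, h1, h2, h4, Pi.sub_apply]
    have e : G (pt t fun j => u j (x n) t) * v (x n) t - G (pt t fun j => u j x₀ t) * v x₀ t
        = (G (pt t fun j => u j (x n) t) - G (pt t fun j => u j x₀ t)) * v x₀ t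
          + G (pt t fun j => u j (x n) t) * (v (x n) t - v x₀ t) := by ring
    rw [e]
    refine (abs_add_le _ _).trans (add_le_add_right ?_ _)
    rw [abs_mul]
    exact mul_le_mul_of_nonneg_right (hC t h5 _ h3) (abs_nonneg _)
  · refine tendsto_eLpNorm_zero_of_dominated (h := fun t => 2 * C * ‖v x₀ t‖) hpm (fun n => ?_)
      ((Lp.memLp (v x₀)).norm.const_mul _) ?_
    · filter_upwards [hR n, hR₀, ae_restrict_mem measurableSet_Ioi] with t h1 h2 h3
      rw [abs_abs, abs_mul]
      refine mul_le_mul_of_nonneg_right ((abs_sub _ _).trans ?_) (abs_nonneg _)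
      linarith [hC t h3 _ h1, hC t h3 _ h2]
    · filter_upwards [hlim, ae_restrict_mem measurableSet_Ioi] with t h1 h2
      have := (tendsto_comp_pt hG.1 h2 h1).sub_const (G (pt t fun j => u j x₀ t))
      simpa using (this.mul_const (v x₀ t)).abs
  · have e : ∀ n, eLpNorm (fun t => C * |(v (x n) - v x₀ : L2) t|) 2 halfLine
        = ‖C‖ₑ * ‖v (x n) - v x₀‖ₑ := by
      intro n
      rw [Lp.enorm_def, ← eLpNorm_norm (v (x n) - v x₀ : L2), ← eLpNorm_const_smul]
      rfl
    simp only [e]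
    have h1 : Tendsto (fun n => v (x n) - v x₀) atTop (𝓝 0) := by
      simpa using ((hv.tendsto x₀).comp hx).sub_const (v x₀)
    have h2 := ENNReal.Tendsto.const_mul (a := ‖C‖ₑ) h1.enorm (Or.inr enorm_ne_top)
    simpa using h2

theorem Bd.of_succ {d k : ℕ} {G : ℝ × EuclideanSpace ℝ (Fin d) → ℝ} (h : Bd (k + 1) G) :
    Bd k G := by
  induction k generalizing G with
  | zero => exact h.base
  | succ k ih => exact ⟨h.1, fun i => ih (h.2 i)⟩

/-- Induction through `(G(t,u) v)' = ∂ₓG(t,u) v + ∑ⱼ ∂ⱼG(t,u) (uⱼ' v) + G(t,u) v'`. The inner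
factors `u` need order at least one even for `k = 0`, for the `L^∞` bound; `v` does not. -/
theorem ContH.supMul [SequentialSpace X] {k d : ℕ}
    {G : ℝ × EuclideanSpace ℝ (Fin d) → ℝ} (hG : Bd k G) {u : Fin d → X → L2} {v : X → L2}
    (hu : ∀ j, ContH (max k 1) (u j)) (hv : ContH k v) : ContH k (supMul G u v) := by
  induction k generalizing d v with
  | zero => exact hG.continuous_supMul hu hv
  | succ k ih =>
    have hu1 : ∀ j, ContH 1 (u j) := fun j => (hu j).mono (le_max_right _ _)
    have hum : ∀ j, ContH (max k 1) (u j) := fun j => (hu j).mono (by omega)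
    refine ⟨hG.base.continuous_supMul hu1 hv.continuous, ?_⟩
    have hu' : ∀ j, ContH (k + 1) (u j) := fun j => (hu j).mono (le_max_left _ _)
    choose _ u' hw hc' using hu'
    have hvm : ContH (max k 1) v := hv.mono (by omega)
    have hv1 : ContH 1 v := hv.mono (by omega)
    obtain ⟨-, v', hvw, hvc'⟩ := id hv
    -- The product `v uⱼ'`, as an instance of the induction hypothesis with `d = 1`. The factor `v`
    -- takes the inner place because it has order `k + 1 ≥ 1`, whereas `uⱼ'` may be merely in `L2`.
    let V : Fin d → X → L2 := fun j =>
      Nemytskii.supMul (d := 1) (fun p => p.2 0) (fun _ => v) (u' j)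
    have hV : ∀ j, ContH k (V j) := fun j => ih (Bd.coord k 0) (fun _ => hvm) (hc' j)
    refine ⟨fun x => Nemytskii.supMul (pd none G) u v x
      + ∑ j, Nemytskii.supMul (pd (some j) G) u (V j) x + Nemytskii.supMul G u v' x,
      fun x => ?_, ?_⟩
    · choose w hw1 hw2 using fun j => (hw j x).exists_isACPrimitive
      obtain ⟨z, hz1, hz2⟩ := (hvw x).exists_isACPrimitive
      refine (((IsACPrimitive.comp hG.1.1 hw1).mul hz1).congr ?_).isWeakDeriv ?_
      · filter_upwards [Lp.coeFn_add (Nemytskii.supMul (pd none G) u v x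
            + ∑ j, Nemytskii.supMul (pd (some j) G) u (V j) x) (Nemytskii.supMul G u v' x),
          Lp.coeFn_add (Nemytskii.supMul (pd none G) u v x)
            (∑ j, Nemytskii.supMul (pd (some j) G) u (V j) x),
          Lp.coeFn_finsetSum Finset.univ fun j => Nemytskii.supMul (pd (some j) G) u (V j) x,
          (hG.2 none).coeFn_supMul hu1 v x,
          ae_all_iff.2 fun j => (hG.2 (some j)).coeFn_supMul hu1 (V j) x,
          ae_all_iff.2 fun j => (Bd.coord k (0 : Fin 1)).coeFn_supMul (fun _ => hv1) (u' j) x,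
          hG.coeFn_supMul hu1 v' x, ae_all_iff.2 hw2, hz2]
          with t e1 e2 e3 e4 e5 e6 e7 e8 e9
        rw [e1, Pi.add_apply, e2, Pi.add_apply, e3, e4, e7]
        simp only [Finset.sum_apply, e5]
        have e6' : ∀ j, V j x t = v x t * u' j x t := fun j => e6 j
        simp only [e6', e8, e9, add_mul, Finset.sum_mul]
        congr 2
        exact Finset.sum_congr rfl fun j _ => by ring
      · filter_upwards [hG.coeFn_supMul hu1 v x, ae_all_iff.2 hw2, hz2] with t e1 e2 e3
        simp only [e1, e2, e3]
    · exact ((ih (hG.2 none) hum hv.of_succ).add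
        (ContH.sum _ fun j => ih (hG.2 (some j)) hum (hV j))).add (ih hG.of_succ hum hvc')

/-! ### Superpositions `G(t, u)` under the growth condition -/

/-- Bounded by `a(t) + C |y|` on `(0, ∞) × B` for every ball `B`, where `a` is square
integrable. -/
def GrowthBound {d : ℕ} (G : ℝ × EuclideanSpace ℝ (Fin d) → ℝ) : Prop :=
  ∃ a : ℝ → ℝ, MemLp a 2 halfLine ∧ ∀ R : ℝ, ∃ C : ℝ, ∀ t > 0, ∀ y, ‖y‖ ≤ R →
    |G (t, y)| ≤ a t + C * ‖y‖

/-- The inductive form of the growth assumption on `(0, ∞) × ℝ^d`. -/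
def Gr {d : ℕ} : ℕ → (ℝ × EuclideanSpace ℝ (Fin d) → ℝ) → Prop
  | 0, G => ContinuousOn G (domain d) ∧ GrowthBound G
  | k + 1, G => (ContDiffOn ℝ 1 G (domain d) ∧ GrowthBound G) ∧ Gr k (pd none G) ∧
      ∀ j, Bd k (pd (some j) G)

theorem Gr.base {d k : ℕ} {G : ℝ × EuclideanSpace ℝ (Fin d) → ℝ} (h : Gr k G) : Gr 0 G := by
  cases k with
  | zero => exact h
  | succ k => exact ⟨h.1.1.continuousOn, h.1.2⟩

theorem Gr.exists_abs_le {d k : ℕ} {G : ℝ × EuclideanSpace ℝ (Fin d) → ℝ} (h : Gr k G) :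
    ∃ a : ℝ → ℝ, MemLp a 2 halfLine ∧ ∀ R : ℝ, ∃ C : ℝ, 0 ≤ C ∧ ∀ t > 0, ∀ y : Fin d → ℝ,
      ‖(WithLp.toLp 2 y : EuclideanSpace ℝ (Fin d))‖ ≤ R → |G (pt t y)| ≤ a t + C * ∑ j, |y j| := by
  obtain ⟨a, ha, hb⟩ := h.base.2
  refine ⟨a, ha, fun R => ?_⟩
  obtain ⟨C, hC⟩ := hb R
  refine ⟨max C 0, le_max_right _ _, fun t ht y hy => (hC t ht _ hy).trans ?_⟩
  gcongr
  · exact le_max_left _ _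
  · exact norm_toLp_le_sum y

theorem memLp_sum_abs {d : ℕ} (u : Fin d → L2) :
    MemLp (fun t => ∑ j, |u j t|) 2 halfLine :=
  memLp_finsetSum _ fun j _ => (Lp.memLp (u j)).norm

theorem Gr.memLp {d k : ℕ} {G : ℝ × EuclideanSpace ℝ (Fin d) → ℝ} (hG : Gr k G)
    {u u' : Fin d → L2} (h : ∀ j, IsWeakDeriv 1 (u j) (u' j)) :
    MemLp (fun t => G (pt t fun j => u j t)) 2 halfLine := by
  obtain ⟨R, hR⟩ := IsWeakDeriv.exists_norm_toLp_le h
  obtain ⟨a, ha, hb⟩ := hG.exists_abs_le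
  obtain ⟨C, hC0, hC⟩ := hb R
  refine (ha.add ((memLp_sum_abs u).const_mul C)).mono'
    (aestronglyMeasurable_comp_pt hG.base.1 u) ?_
  filter_upwards [hR, ae_restrict_mem measurableSet_Ioi] with t ht ht0
  exact hC t ht0 _ ht

/-- The family of functions `G(t, u(t))`. -/
def supComp {d : ℕ} (G : ℝ × EuclideanSpace ℝ (Fin d) → ℝ) (u : Fin d → X → L2) (x : X) : L2 :=
  mkL2 fun t => G (pt t fun j => u j x t)

theorem Gr.coeFn_supComp {d k : ℕ} {G : ℝ × EuclideanSpace ℝ (Fin d) → ℝ} (hG : Gr k G)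
    {u : Fin d → X → L2} (hu : ∀ j, ContH 1 (u j)) (x : X) :
    supComp G u x =ᵐ[halfLine] fun t => G (pt t fun j => u j x t) := by
  choose _ u' hw _ using hu
  exact coeFn_mkL2 (hG.memLp fun j => hw j x)

theorem tendsto_eLpNorm_sum_abs_sub {d : ℕ} {u : ℕ → Fin d → L2} {u₀ : Fin d → L2}
    (h : ∀ j, Tendsto (fun n => u n j) atTop (𝓝 (u₀ j))) :
    Tendsto (fun n => eLpNorm (fun t => ∑ j, |(u n j - u₀ j : L2) t|) 2 halfLine) atTop
      (𝓝 0) := by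
  have h1 : Tendsto (fun n => ∑ j, ‖u n j - u₀ j‖ₑ) atTop (𝓝 (∑ _j : Fin d, 0)) := by
    refine tendsto_finsetSum _ fun j _ => ?_
    have : Tendsto (fun n => u n j - u₀ j) atTop (𝓝 0) := by
      simpa using (h j).sub_const (u₀ j)
    simpa using this.enorm
  rw [Finset.sum_const_zero] at h1
  refine tendsto_of_tendsto_of_tendsto_of_le_of_le tendsto_const_nhds h1 (fun _ => zero_le)
    fun n => ?_
  have e : (fun t => ∑ j, |(u n j - u₀ j : L2) t|)
      = ∑ j, fun t => ‖(u n j - u₀ j : L2) t‖ := by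
    funext t
    simp [Finset.sum_apply]
  rw [e]
  refine (eLpNorm_sum_le (fun j _ => (Lp.aestronglyMeasurable (u n j - u₀ j)).norm)
    one_le_two).trans (Finset.sum_le_sum fun j _ => ?_)
  rw [Lp.enorm_def, eLpNorm_norm]

theorem Gr.continuous_supComp [SequentialSpace X] {d : ℕ}
    {G : ℝ × EuclideanSpace ℝ (Fin d) → ℝ} (hG : Gr 0 G)
    {u : Fin d → X → L2} (hu : ∀ j, ContH 1 (u j)) : Continuous (supComp G u) := by
  rw [continuous_iff_seqContinuous]
  intro x x₀ hx
  obtain ⟨⟨R, hR, hR₀⟩, hlim⟩ := ContH.exists_bound_tendsto hu hx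
  obtain ⟨a, ha, hb⟩ := hG.exists_abs_le
  obtain ⟨C, hC0, hC⟩ := hb R
  have hGm : ∀ x, AEStronglyMeasurable (fun t => G (pt t fun j => u j x t)) halfLine := fun x =>
    aestronglyMeasurable_comp_pt hG.1 fun j => u j x
  let h : ℝ → ℝ := fun t => 2 * |a t| + 2 * C * ∑ j, |u j x₀ t|
  have hh0 : ∀ t, 0 ≤ h t := fun t => by positivity
  have hh : MemLp h 2 halfLine :=
    (ha.norm.const_mul 2).add ((memLp_sum_abs fun j => u j x₀).const_mul (2 * C))
  -- The growth bound gives only `|G(t,uₙ) - G(t,u₀)| ≤ h + eₙ`. Truncating the difference at the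
  -- fixed `h` makes it dominated, and the excess is at most `eₙ`, which tends to zero in `L2`.
  let p : ℕ → ℝ → ℝ := fun n t =>
    min |G (pt t fun j => u j (x n) t) - G (pt t fun j => u j x₀ t)| (h t)
  let e : ℕ → ℝ → ℝ := fun n => C • fun t => ∑ j, |(u j (x n) - u j x₀ : L2) t|
  have hpm : ∀ n, AEStronglyMeasurable (p n) halfLine := fun n =>
    (((hGm _).sub (hGm _)).norm).inf hh.1
  have hem : ∀ n, AEStronglyMeasurable (e n) halfLine := fun n =>
    ((memLp_sum_abs fun j => u j (x n) - u j x₀).const_smul C).1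
  refine tendsto_L2_of_abs_sub_le (p := p) (e := e) (fun n => ?_) hpm hem ?_ ?_
  · filter_upwards [hG.coeFn_supComp hu (x n), hG.coeFn_supComp hu x₀, hR n, hR₀,
      ae_all_iff.2 fun j => Lp.coeFn_sub (u j (x n)) (u j x₀),
      ae_restrict_mem measurableSet_Ioi] with t h1 h2 h3 h4 h5 h6
    rw [Function.comp_apply, h1, h2]
    have hsum : ∑ j, |u j (x n) t|
        ≤ ∑ j, |u j x₀ t| + ∑ j, |(u j (x n) - u j x₀ : L2) t| := by
      rw [← Finset.sum_add_distrib]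
      refine Finset.sum_le_sum fun j _ => ?_
      rw [h5 j, Pi.sub_apply]
      linarith [abs_sub_abs_le_abs_sub (u j (x n) t) (u j x₀ t)]
    have he0 : 0 ≤ e n t := by
      change 0 ≤ C * ∑ j, |(u j (x n) - u j x₀ : L2) t|
      positivity
    have hle : |G (pt t fun j => u j (x n) t) - G (pt t fun j => u j x₀ t)| ≤ h t + e n t := by
      refine (abs_sub _ _).trans ((add_le_add (hC t h6 _ h3) (hC t h6 _ h4)).trans ?_)
      change _ ≤ 2 * |a t| + 2 * C * ∑ j, |u j x₀ t| + C * ∑ j, |(u j (x n) - u j x₀ : L2) t|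
      have := mul_le_mul_of_nonneg_left hsum hC0
      linarith [le_abs_self (a t)]
    rcases min_cases |G (pt t fun j => u j (x n) t) - G (pt t fun j => u j x₀ t)| (h t)
      with ⟨hm, -⟩ | ⟨hm, -⟩
    · change _ ≤ min _ _ + _
      rw [hm]
      linarith
    · change _ ≤ min _ _ + _
      rwa [hm]
  · refine tendsto_eLpNorm_zero_of_dominated hpm (fun n => Eventually.of_forall fun t => ?_) hh ?_
    · rw [abs_of_nonneg (le_min (abs_nonneg _) (hh0 t))]
      exact min_le_right _ _
    · filter_upwards [hlim, ae_restrict_mem measurableSet_Ioi] with t h1 h2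
      have h3 := ((tendsto_comp_pt hG.1 h2 h1).sub_const
        (G (pt t fun j => u j x₀ t))).abs
      rw [sub_self, abs_zero] at h3
      exact squeeze_zero (fun n => le_min (abs_nonneg _) (hh0 t)) (fun n => min_le_left _ _) h3
  · have h1 : ∀ j, Tendsto (fun n => u j (x n)) atTop (𝓝 (u j x₀)) := fun j =>
      ((hu j).continuous.tendsto x₀).comp hx
    have h2 := ENNReal.Tendsto.const_mul (a := ‖C‖ₑ)
      (tendsto_eLpNorm_sum_abs_sub (u := fun n j => u j (x n)) h1) (Or.inr enorm_ne_top)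
    rw [mul_zero] at h2
    exact h2.congr fun n => (eLpNorm_const_smul _ _ _ _).symm

/-- By the chain rule, the `x`-derivative term falls under the induction hypothesis and the terms
with `uⱼ'` under `ContH.supMul`. -/
theorem ContH.supComp [SequentialSpace X] {k d : ℕ}
    {G : ℝ × EuclideanSpace ℝ (Fin d) → ℝ} (hG : Gr k G) {u : Fin d → X → L2}
    (hu : ∀ j, ContH (max k 1) (u j)) : ContH k (supComp G u) := by
  induction k generalizing G with
  | zero => exact hG.continuous_supComp hu
  | succ k ih =>
    have hu1 : ∀ j, ContH 1 (u j) := fun j => (hu j).mono (le_max_right _ _)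
    have hum : ∀ j, ContH (max k 1) (u j) := fun j => (hu j).mono (by omega)
    refine ⟨hG.base.continuous_supComp hu1, ?_⟩
    have hu' : ∀ j, ContH (k + 1) (u j) := fun j => (hu j).mono (le_max_left _ _)
    choose _ u' hw hc' using hu'
    refine ⟨fun x => Nemytskii.supComp (pd none G) u x
      + ∑ j, Nemytskii.supMul (pd (some j) G) u (u' j) x, fun x => ?_, ?_⟩
    · choose w hw1 hw2 using fun j => (hw j x).exists_isACPrimitive
      refine ((IsACPrimitive.comp hG.1.1 hw1).congr ?_).isWeakDeriv ?_
      · filter_upwards [Lp.coeFn_add (Nemytskii.supComp (pd none G) u x)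
            (∑ j, Nemytskii.supMul (pd (some j) G) u (u' j) x),
          Lp.coeFn_finsetSum Finset.univ fun j => Nemytskii.supMul (pd (some j) G) u (u' j) x,
          hG.2.1.coeFn_supComp hu1 x,
          ae_all_iff.2 fun j => (hG.2.2 j).coeFn_supMul hu1 (u' j) x, ae_all_iff.2 hw2]
          with t e1 e2 e3 e4 e5
        rw [e1, Pi.add_apply, e2, e3]
        simp only [Finset.sum_apply, e4, e5]
      · filter_upwards [hG.coeFn_supComp hu1 x, ae_all_iff.2 hw2] with t e1 e2
        simp only [e1, e2]
    · exact (ih hG.2.1 hum).add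
        (ContH.sum _ fun j => ContH.supMul (hG.2.2 j) hum (hc' j))

/-! ### Iterated directional derivatives -/

section IteratedDirectional

variable {V : Type*} [NormedAddCommGroup V] [NormedSpace ℝ V]

/-- The iterated directional derivative along a list of directions. -/
def dirDeriv (f : V → ℝ) : List V → V → ℝ
  | [], p => f p
  | v :: K, p => fderiv ℝ (dirDeriv f K) p v

variable {f : V → ℝ} {U : Set V} {m : ℕ}

theorem contDiffOn_dirDeriv (hU : IsOpen U) (hf : ContDiffOn ℝ m f U) (K : List V) (k : ℕ)
    (hk : K.length + k ≤ m) : ContDiffOn ℝ k (dirDeriv f K) U := by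
  induction K generalizing k with
  | nil => exact hf.of_le (by simpa using hk)
  | cons v K ih =>
    have h := ih (k + 1) (by simp at hk; omega)
    exact (h.fderiv_of_isOpen hU (by norm_cast)).clm_apply contDiffOn_const

theorem fderiv_eq_of_eqOn {g h : V → ℝ} (hU : IsOpen U) (e : EqOn g h U) {p : V} (hp : p ∈ U) :
    fderiv ℝ g p = fderiv ℝ h p :=
  (e.eventuallyEq_of_mem (hU.mem_nhds hp)).fderiv_eq

/-- Adjacent transpositions suffice, and these are the symmetry of the second derivative of
`dirDeriv f K`, which is still `C²` because the two extra directions fit within the order `m`. -/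
theorem dirDeriv_perm_of_contDiffOn (hU : IsOpen U) (hf : ContDiffOn ℝ m f U) {K K' : List V}
    (h : K.Perm K') (hK : K.length ≤ m) : EqOn (dirDeriv f K) (dirDeriv f K') U := by
  induction h with
  | nil => exact fun _ _ => rfl
  | cons v _ ih =>
    intro p hp
    simp only [dirDeriv, fderiv_eq_of_eqOn hU (ih (by simp at hK; omega)) hp]
  | swap v w K =>
    intro p hp
    have h2 : ContDiffOn ℝ 2 (dirDeriv f K) U :=
      contDiffOn_dirDeriv hU hf K 2 (by simp at hK; omega)
    have hd : DifferentiableAt ℝ (fderiv ℝ (dirDeriv f K)) p :=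
      ((h2.fderiv_of_isOpen hU (m := 1) (by norm_num)).differentiableOn one_ne_zero).differentiableAt
        (hU.mem_nhds hp)
    have e : ∀ a b : V, dirDeriv f (a :: b :: K) p
        = fderiv ℝ (fderiv ℝ (dirDeriv f K)) p a b := by
      intro a b
      change fderiv ℝ (fun q => fderiv ℝ (dirDeriv f K) q b) p a = _
      rw [fderiv_clm_apply hd (differentiableAt_const b)]
      simp
    rw [e, e]
    exact ((h2.contDiffAt (hU.mem_nhds hp)).isSymmSndFDerivAt (by simp)) _ _
  | trans h1 _ ih1 ih2 => exact (ih1 hK).trans (ih2 (h1.length_eq ▸ hK))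

theorem dirDeriv_eq_iteratedFDeriv_of_contDiffOn (hU : IsOpen U) (hf : ContDiffOn ℝ m f U)
    (K : List V) (hK : K.length ≤ m) :
    EqOn (dirDeriv f K) (fun p => iteratedFDeriv ℝ K.length f p K.get) U := by
  induction K with
  | nil => exact fun p _ => (iteratedFDeriv_zero_apply _).symm
  | cons v K ih =>
    intro p hp
    simp only [List.length_cons] at hK
    have hd : DifferentiableAt ℝ (iteratedFDeriv ℝ K.length f) p :=
      (hf.contDiffAt (hU.mem_nhds hp)).differentiableAt_iteratedFDeriv (by exact_mod_cast hK)
    change fderiv ℝ (dirDeriv f K) p v = _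
    rw [fderiv_eq_of_eqOn hU (ih (by omega)) hp]
    exact (hd.iteratedFDeriv_succ_apply_left' (m := (v :: K).get)).symm

end IteratedDirectional

/-! ### From the growth assumption to the inductive classes -/

variable {d m : ℕ} {μ : ℝ → EuclideanSpace ℝ (Fin d) → ℝ}

theorem GrowthAssumption.contDiffOn_domain (h : GrowthAssumption m μ) :
    ContDiffOn ℝ m (fun p : ℝ × EuclideanSpace ℝ (Fin d) => μ p.1 p.2) (domain d) :=
  h.contDiffOn.mono (prod_mono Ioi_subset_Ici_self subset_rfl)

/-- The inductions differentiate in arbitrary order, while `partialDeriv` fixes one. For `t > 0` the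
closed half-space is a neighbourhood of the point, so derivatives within it are ordinary ones. -/
theorem GrowthAssumption.dirDeriv_eq_partialDeriv (h : GrowthAssumption m μ) {l : ℕ}
    {β : Fin d → ℕ} {K : List (ℝ × EuclideanSpace ℝ (Fin d))} (hK : K.Perm (directions l β))
    (hm : K.length ≤ m) {t : ℝ} (ht : 0 < t) (y : EuclideanSpace ℝ (Fin d)) :
    dirDeriv (fun p : ℝ × EuclideanSpace ℝ (Fin d) => μ p.1 p.2) K (t, y)
      = partialDeriv l β μ t y := by
  have hp : (t, y) ∈ domain d := ⟨ht, mem_univ _⟩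
  rw [dirDeriv_perm_of_contDiffOn (isOpen_domain d) h.contDiffOn_domain hK hm hp,
    dirDeriv_eq_iteratedFDeriv_of_contDiffOn (isOpen_domain d) h.contDiffOn_domain _
      (hK.length_eq ▸ hm) hp, partialDeriv]
  have e : (Ici 0 ×ˢ univ : Set (ℝ × EuclideanSpace ℝ (Fin d))) =ᶠ[𝓝 (t, y)] univ :=
    eventuallyEq_univ.2 (mem_of_superset ((isOpen_domain d).mem_nhds hp)
      (prod_mono Ioi_subset_Ici_self subset_rfl))
  rw [iteratedFDerivWithin_congr_set e, iteratedFDerivWithin_univ]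

/-- The multi-index counts the occurrences of each direction. The last clause is the condition `α₁ ≠
|α|` under which the local bounds are assumed. -/
theorem exists_perm_directions (M : List (Option (Fin d))) :
    ∃ (l : ℕ) (β : Fin d → ℕ), (M.map dir).Perm (directions l β) ∧ l + ∑ j, β j = M.length ∧
      ∀ j, some j ∈ M → l ≠ l + ∑ j, β j := by
  let β : Fin d → ℕ := fun j => M.count (some j)
  let M' : List (Option (Fin d)) := List.replicate (M.count none) none ++
    (List.finRange d).flatMap fun j => List.replicate (β j) (some j)
  have hperm : M.Perm M' := by
    rw [List.perm_iff_count]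
    intro a
    rw [List.count_append, List.count_flatMap]
    cases a with
    | none =>
      simp [Function.comp_def, List.count_replicate]
    | some j =>
      have : ((List.finRange d).map
          (List.count (some j) ∘ fun i => List.replicate (β i) (some i))).sum = β j := by
        rw [← Fin.sum_univ_def]
        simp [List.count_replicate]
      rw [this]
      simp [List.count_replicate, β]
  have hmap : M'.map dir = directions (M.count none) β := by
    simp [M', directions, List.map_flatMap, dir]
  have hlen : M.count none + ∑ j, β j = M.length := by
    rw [hperm.length_eq]
    simp [M', List.length_flatMap, Fin.sum_univ_def]
  refine ⟨M.count none, β, hmap ▸ hperm.map dir, hlen, fun j hj => ?_⟩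
  have h1 : 0 < β j := List.count_pos_iff.2 hj
  have h2 : β j ≤ ∑ j, β j := Finset.single_le_sum (fun _ _ => Nat.zero_le _) (Finset.mem_univ j)
  omega

theorem IsLocallyBounded.exists_le {f : EuclideanSpace ℝ (Fin d) → ℝ≥0∞} (h : IsLocallyBounded f)
    (R : ℝ) : ∃ C : ℝ≥0, ∀ y, ‖y‖ ≤ R → f y ≤ C := by
  have : ∃ C : ℝ≥0, ∀ y ∈ Metric.closedBall (0 : EuclideanSpace ℝ (Fin d)) R, f y ≤ C := by
    refine (isCompact_closedBall _ _).induction_on (p := fun s => ∃ C : ℝ≥0, ∀ y ∈ s, f y ≤ C)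
      ⟨0, by simp⟩ (fun s t hst ⟨C, hC⟩ => ⟨C, fun y hy => hC y (hst hy)⟩) ?_ ?_
    · rintro s t ⟨C, hC⟩ ⟨C', hC'⟩
      refine ⟨max C C', fun y hy => ?_⟩
      rcases hy with hy | hy
      · exact (hC y hy).trans (by exact_mod_cast le_max_left C C')
      · exact (hC' y hy).trans (by exact_mod_cast le_max_right C C')
    · intro y _
      obtain ⟨C, hC⟩ := h y
      exact ⟨_, mem_nhdsWithin_of_mem_nhds hC, C, fun z hz => hz⟩
  obtain ⟨C, hC⟩ := this
  exact ⟨C, fun y hy => hC y (mem_closedBall_zero_iff.2 hy)⟩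

theorem pd_eqOn {G H : ℝ × EuclideanSpace ℝ (Fin d) → ℝ} (h : EqOn G H (domain d))
    (i : Option (Fin d)) : EqOn (pd i G) (pd i H) (domain d) := fun p hp => by
  rw [pd, pd, fderiv_eq_of_eqOn (isOpen_domain d) h hp]

theorem GrowthAssumption.boundedOnBalls (h : GrowthAssumption m μ) {M : List (Option (Fin d))}
    {j : Fin d} (hj : some j ∈ M) (hM : M.length ≤ m) :
    BoundedOnBalls (dirDeriv (fun p : ℝ × EuclideanSpace ℝ (Fin d) => μ p.1 p.2)
      (M.map dir)) := by
  obtain ⟨l, β, hperm, hlen, hne⟩ := exists_perm_directions M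
  intro R
  obtain ⟨C, hC⟩ := (h.locallyBounded l β (hne j hj) (hlen ▸ hM)).exists_le R
  refine ⟨C, fun t ht y hy => ?_⟩
  rw [h.dirDeriv_eq_partialDeriv hperm (by simpa using hM) ht y]
  have h1 : ‖partialDeriv l β μ t y‖ₑ ≤ C :=
    (le_iSup₂ (f := fun x (_ : x ∈ Ioi (0 : ℝ)) => ‖partialDeriv l β μ x y‖ₑ) t ht).trans (hC y hy)
  exact enorm_le_coe.1 h1

theorem BoundedOnBalls.congr {G H : ℝ × EuclideanSpace ℝ (Fin d) → ℝ} (h : BoundedOnBalls G)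
    (e : EqOn H G (domain d)) : BoundedOnBalls H := fun R => (h R).imp fun C hC t ht y hy => by
  have hp : (t, y) ∈ domain d := ⟨ht, mem_univ _⟩
  rw [e hp]
  exact hC t ht y hy

theorem GrowthBound.congr {G H : ℝ × EuclideanSpace ℝ (Fin d) → ℝ} (h : GrowthBound G)
    (e : EqOn H G (domain d)) : GrowthBound H := by
  obtain ⟨a, ha, hb⟩ := h
  refine ⟨a, ha, fun R => (hb R).imp fun C hC t ht y hy => ?_⟩
  have hp : (t, y) ∈ domain d := ⟨ht, mem_univ _⟩
  rw [e hp]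
  exact hC t ht y hy

/-- Once a `y`-direction occurs in `M`, it occurs in every longer list, so all further derivatives
are bounded over balls. -/
theorem GrowthAssumption.bd (h : GrowthAssumption m μ) (k : ℕ) {M : List (Option (Fin d))}
    {j : Fin d} (hj : some j ∈ M) (hM : M.length + k ≤ m)
    {H : ℝ × EuclideanSpace ℝ (Fin d) → ℝ}
    (hH : EqOn H (dirDeriv (fun p => μ p.1 p.2) (M.map dir)) (domain d)) : Bd k H := by
  induction k generalizing M H with
  | zero =>
    exact ⟨((contDiffOn_dirDeriv (isOpen_domain d) h.contDiffOn_domain _ 0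
      (by simpa using hM)).congr hH).continuousOn, (h.boundedOnBalls hj (by omega)).congr hH⟩
  | succ k ih =>
    refine ⟨⟨(contDiffOn_dirDeriv (isOpen_domain d) h.contDiffOn_domain _ 1
      (by simp; omega)).congr hH, (h.boundedOnBalls hj (by omega)).congr hH⟩, fun i => ?_⟩
    exact ih (M := i :: M) (List.mem_cons_of_mem i hj) (by rw [List.length_cons]; omega)
      (pd_eqOn hH i)

theorem GrowthAssumption.growthBound (h : GrowthAssumption m μ) {l : ℕ} (hl : l ≤ m) :
    GrowthBound (dirDeriv (fun p : ℝ × EuclideanSpace ℝ (Fin d) => μ p.1 p.2)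
      ((List.replicate l none).map dir)) := by
  obtain ⟨a, b, ha, hb, hab⟩ := h.growth l hl
  refine ⟨a, ha, fun R => ?_⟩
  obtain ⟨C, hC⟩ := hb.exists_le R
  refine ⟨C, fun t ht y hy => ?_⟩
  have hperm : ((List.replicate l none).map dir).Perm (directions l (0 : Fin d → ℕ)) := by
    simp [directions, dir]
  rw [h.dirDeriv_eq_partialDeriv hperm (by simpa using hl) ht y]
  refine (hab t ht y).trans ?_
  gcongr
  exact_mod_cast hC y hy

/-- Pure `x`-derivatives keep the growth bound; the first `y`-derivative passes to
`GrowthAssumption.bd`. -/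
theorem GrowthAssumption.gr (h : GrowthAssumption m μ) (k : ℕ) {l : ℕ} (hl : l + k ≤ m)
    {H : ℝ × EuclideanSpace ℝ (Fin d) → ℝ}
    (hH : EqOn H (dirDeriv (fun p => μ p.1 p.2) ((List.replicate l none).map dir)) (domain d)) :
    Gr k H := by
  have hb : GrowthBound H := (h.growthBound (by omega)).congr hH
  induction k generalizing l H with
  | zero =>
    exact ⟨((contDiffOn_dirDeriv (isOpen_domain d) h.contDiffOn_domain _ 0
      (by simpa using hl)).congr hH).continuousOn, hb⟩
  | succ k ih =>
    have e : ∀ i, EqOn (pd i H)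
        (dirDeriv (fun p => μ p.1 p.2) ((i :: List.replicate l none).map dir)) (domain d) :=
      pd_eqOn hH
    exact ⟨⟨(contDiffOn_dirDeriv (isOpen_domain d) h.contDiffOn_domain _ 1
      (by simp; omega)).congr hH, hb⟩,
      ih (l := l + 1) (by omega) (e none) ((h.growthBound (l := l + 1) (by omega)).congr (e none)),
      fun j => h.bd k (List.mem_cons_self (a := some j)) (by simp; omega) (e (some j))⟩

/-! ### Comparison of `ContH` with the Sobolev space -/

theorem IsTestFunction.iteratedDeriv {φ : ℝ → ℝ} (h : IsTestFunction φ) (k : ℕ) :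
    IsTestFunction (iteratedDeriv k φ) := by
  induction k with
  | zero => simpa using h
  | succ k ih =>
    rw [iteratedDeriv_succ]
    exact isTestFunction_deriv ih

/-- `H^m` is defined by derivatives of each order of `u` itself, `ContH` by successive first
derivatives. Testing against `φ'` passes from the former to the latter; `IsWeakDeriv.comp_one` goes
back. -/
theorem IsWeakDeriv.one_of_succ {k : ℕ} {u v w : L2} (h : IsWeakDeriv k u v)
    (h' : IsWeakDeriv (k + 1) u w) : IsWeakDeriv 1 v w := by
  intro φ hφ
  have h1 := h _ (isTestFunction_deriv hφ)
  have h2 := h' φ hφ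
  rw [iteratedDeriv_succ', h1, pow_succ, mul_assoc] at h2
  rw [iteratedDeriv_one, pow_one]
  exact mul_left_cancel₀ (pow_ne_zero k (by norm_num)) h2

theorem IsWeakDeriv.comp_one {k : ℕ} {u v w : L2} (h : IsWeakDeriv 1 u v)
    (h' : IsWeakDeriv k v w) : IsWeakDeriv (k + 1) u w := by
  intro φ hφ
  have h1 := h _ (hφ.iteratedDeriv k)
  rw [iteratedDeriv_one, h' φ hφ] at h1
  rw [iteratedDeriv_succ, h1, pow_succ]
  ring

theorem SobolevH.continuous_jet : Continuous (SobolevH.jet (m := m)) := continuous_induced_dom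

theorem SobolevH.continuous_weakDeriv (k : Fin (m + 1)) :
    Continuous (SobolevH.weakDeriv (m := m) k) :=
  (PiLp.continuous_apply 2 (fun _ : Fin (m + 1) => L2) k).comp SobolevH.continuous_jet

theorem SobolevH.contH_weakDeriv (n k : ℕ) (h : k + n = m) :
    ContH n (fun u : SobolevH m => SobolevH.weakDeriv ⟨k, by omega⟩ u) := by
  induction n generalizing k with
  | zero => exact SobolevH.continuous_weakDeriv _
  | succ n ih =>
    refine ⟨SobolevH.continuous_weakDeriv _, _, fun u => ?_, ih (k + 1) (by omega)⟩
    exact (SobolevH.isWeakDeriv_weakDeriv ⟨k, by omega⟩ u).one_of_succ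
      (SobolevH.isWeakDeriv_weakDeriv ⟨k + 1, by omega⟩ u)

variable {Y : Type*} [TopologicalSpace Y]

theorem ContH.comp {k : ℕ} {F : X → L2} (h : ContH k F) {g : Y → X} (hg : Continuous g) :
    ContH k (F ∘ g) := by
  induction k generalizing F with
  | zero => exact Continuous.comp h hg
  | succ k ih =>
    obtain ⟨h1, F', h2, h3⟩ := h
    exact ⟨h1.comp hg, _, fun y => h2 (g y), ih h3⟩

theorem ContH.exists_weakDeriv {n : ℕ} {F : X → L2} (h : ContH n F) {k : ℕ} (hk : k ≤ n) :
    ∃ F' : X → L2, Continuous F' ∧ ∀ x, IsWeakDeriv k (F x) (F' x) := by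
  induction k generalizing n F with
  | zero => exact ⟨F, h.continuous, fun x φ _ => by simp⟩
  | succ k ih =>
    obtain ⟨n, rfl⟩ : ∃ n', n = n' + 1 := ⟨n - 1, by omega⟩
    obtain ⟨-, F', h2, h3⟩ := h
    obtain ⟨F'', h4, h5⟩ := ih h3 (by omega)
    exact ⟨F'', h4, fun x => (h2 x).comp_one (h5 x)⟩

/-- The topology of `H^m` is induced by `jet`, so continuity may be checked on each weak derivative,
and these are the given ones by uniqueness. -/
theorem ContH.exists_continuous_sobolevH {F : X → L2} (h : ContH m F) :
    ∃ N : X → SobolevH m, (∀ x, SobolevH.toL2 (N x) = F x) ∧ Continuous N := by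
  choose F' hc hw using fun k : Fin (m + 1) => h.exists_weakDeriv (Nat.lt_succ_iff.1 k.2)
  let N : X → SobolevH m := fun x => ⟨F x, fun k hk => ⟨_, hw ⟨k, Nat.lt_succ_iff.2 hk⟩ x⟩⟩
  refine ⟨N, fun _ => rfl, continuous_induced_rng.2 ?_⟩
  have e : SobolevH.jet ∘ N = fun x => WithLp.toLp 2 fun k => F' k x := by
    funext x
    ext1 k
    exact (SobolevH.isWeakDeriv_weakDeriv k (N x)).unique (hw k x)
  rw [e]
  exact (PiLp.continuous_toLp 2 _).comp (continuous_pi hc)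

end Nemytskii

end

theorem mainTheorem10 (m d : ℕ) (hm : 1 ≤ m) (μ : ℝ → EuclideanSpace ℝ (Fin d) → ℝ)
    (hμ : Nemytskii.GrowthAssumption m μ) :
    ∃ N : (Fin d → Nemytskii.SobolevH m) → Nemytskii.SobolevH m,
      (∀ u : Fin d → Nemytskii.SobolevH m, ∀ᵐ x ∂volume.restrict (Ioi (0 : ℝ)),
        N u x = μ x (WithLp.toLp 2 fun j => u j x)) ∧
      Continuous N := by
  have hG : Nemytskii.Gr m (fun p : ℝ × EuclideanSpace ℝ (Fin d) => μ p.1 p.2) :=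
    hμ.gr m (l := 0) (by omega) fun _ _ => rfl
  have hu : ∀ j, Nemytskii.ContH m
      (fun u : Fin d → Nemytskii.SobolevH m => Nemytskii.SobolevH.toL2 (u j)) := fun j => by
    have h := (Nemytskii.SobolevH.contH_weakDeriv (m := m) m 0 (by omega)).comp
      (continuous_apply (A := fun _ : Fin d => Nemytskii.SobolevH m) j)
    have e : (fun u : Fin d → Nemytskii.SobolevH m => Nemytskii.SobolevH.toL2 (u j))
        = (fun u => Nemytskii.SobolevH.weakDeriv 0 u) ∘ fun u => u j :=
      funext fun u => (Nemytskii.SobolevH.weakDeriv_zero (u j)).symm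
    rw [e]
    exact h
  -- Here `1 ≤ m` enters: the available order `m` of the family equals the required `max m 1`.
  obtain ⟨N, hN, hc⟩ := (Nemytskii.ContH.supComp hG
    (by rwa [max_eq_left hm])).exists_continuous_sobolevH
  refine ⟨N, fun u => ?_, hc⟩
  rw [hN]
  exact hG.coeFn_supComp (fun j => (hu j).mono hm) u
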